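/- Let $N\ge 0$ be an integer, let $H_0\in\mathbb C^{N\times N}$ be Hermitian, let $(B_\mu)_\mu$ be a finite family of anti-Hermitian $N\times N$ matrices, $B_\mu^\dagger=-B_\mu$, and let $a\in\mathbb R$. Let $(W_t)_{t\ge0}$ be a Brownian motion on the Lie algebra $\mathfrak u(N)$ of anti-Hermitian matrices, i.e. a process with independent stationary increments and almost surely continuous paths, whose increments $\Theta_{\ell,\Delta t}=\frac1{\Delta t}\left(W_{\ell\Delta t}-W_{(\ell-1)\Delta t}\right)$, for all $\Delta t>0$ and $\ell\ge1$, are almost surely of the form $$\Theta_{\ell,\Delta t}=-\mathrm i H_0+\sum_\mu B_\mu\,\xi^\mu_{\ell,\Delta t},$$ where the $\xi^\mu_{\ell,\Delta t}$ are real square-integrable random variables with $$\mathbb E[\xi^\mu_{\ell,\Delta t}]=0,\qquad \mathbb E[\xi^\mu_{\ell,\Delta t}\,\xi^\nu_{\ell,\Delta t}]=\frac{a}{\Delta t}\,\delta_{\mu,\nu}$$ (so that $a\ge 0$ as soon as there is a noise operator). Let $(U_t)_{t\ge0}$ be a Brownian motion on the unitary group $\mathrm U(N)$, i.e. a process for which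 the increments $U_{t_1}U_{0}^\dagger,U_{t_2}U_{t_1}^\dagger,\dots,U_{t_m}U_{t_{m-1}}^\dagger$ are independent for all $0<t_1<\dots<t_m$, for which $U_{t+\Delta t}U_t^\dagger$ is equal in distribution to $U_{\Delta t}U_0^\dagger$ for all $t\ge0$, $\Delta t>0$, and whose paths are almost surely continuous. Suppose that $U_0=\mathbb 1$ almost surely and that $U$ is generated by the increments of $W$: for every $t\ge0$, $$U_t=\lim_{m\to\infty}\mathrm e^{W_{t}-W_{(m-1)t/m}}\cdots\mathrm e^{W_{2t/m}-W_{t/m}}\,\mathrm e^{W_{t/m}-W_0}\,U_0\qquad\text{in probability.}$$ Then, for every $\rho\in\mathbb C^{N\times N}$ (in particular for every density matrix) and every $t\ge 0$, the average $\rho(t)=\mathbb E[U_t\,\rho\,U_t^\dagger]$ exists, the maps $\rho\mapsto\rho(t)$, $t\ge0$, form a quantum dynamical semigroup, i.e. a continuous one-parameter semigroup of completely positive trace-preserving linear maps that is the identity at $t=0$, and $\rho(t)$ satisfies the Lindblad equation $$\frac{d}{dt}\rho(t)=-\mathrm i\,[H_0,\rho(t)]+a\sum_\mu\left(B_\mu\,\rho(t)\,B_\mu^\dagger-\tfrac12\left(B_\mu^\dagger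 B_\mu\,\rho(t)+\rho(t)\,B_\mu^\dagger B_\mu\right)\right)\qquad(t\ge0),$$ with $\rho(0)=\rho$ (one-sided derivative at $t=0$). -/

import Mathlib

open MeasureTheory ProbabilityTheory Filter Topology
open scoped NNReal Matrix Matrix.Norms.L2Operator MatrixOrder CStarAlgebra

/-- Complex square matrices carry their Borel `σ`-algebra; the unitary group and the Lie algebra of
anti-Hermitian matrices carry the trace `σ`-algebra. -/
noncomputable instance matrixMeasurableSpace {n : Type*} : MeasurableSpace (Matrix n n ℂ) := borel _

instance matrixBorelSpace {n : Type*} : BorelSpace (Matrix n n ℂ) := ⟨rfl⟩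

section Processes

variable {n Ω : Type*} [Fintype n] [DecidableEq n] [MeasurableSpace Ω]

/-- Brownian motion (with drift and arbitrary covariance) on the Lie algebra `𝔲(n)` of anti-Hermitian
matrices: a process with independent and stationary increments and almost surely continuous paths.
That the increments are Gaussian is a consequence and is not part of the definition. -/
structure IsLieAlgebraBrownianMotion (W : ℝ≥0 → Ω → skewAdjoint (Matrix n n ℂ))
    (P : Measure Ω) : Prop where
  measurable : ∀ t, Measurable (W t)
  indep_increments : HasIndepIncrements W P
  stationary : ∀ t δ : ℝ≥0, 0 < δ →
    IdentDistrib (fun ω => W (t + δ) ω - W t ω) (fun ω => W δ ω - W 0 ω) P P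
  continuous_paths : ∀ᵐ ω ∂P, Continuous fun t => W t ω

/-- Brownian motion on the unitary group `U(n)`: a process with independent and stationary left
increments `U_{t'} U_t†` and almost surely continuous paths. -/
structure IsUnitaryBrownianMotion (U : ℝ≥0 → Ω → Matrix.unitaryGroup n ℂ)
    (P : Measure Ω) : Prop where
  measurable : ∀ t, Measurable (U t)
  indep_increments : ∀ (m : ℕ) (t : Fin (m + 1) → ℝ≥0), t 0 = 0 → StrictMono t →
    iIndepFun (fun (i : Fin m) ω => U (t i.succ) ω * (U (t i.castSucc) ω)⁻¹) P
  stationary : ∀ t δ : ℝ≥0, 0 < δ →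
    IdentDistrib (fun ω => U (t + δ) ω * (U t ω)⁻¹) (fun ω => U δ ω * (U 0 ω)⁻¹) P P
  continuous_paths : ∀ᵐ ω ∂P, Continuous fun t => U t ω

/-- The increment `Θ = (W_{(ℓ+1)δ} - W_{ℓδ}) / δ` over the `ℓ`-th time step of length `δ`,
the steps being numbered from `0`. -/
noncomputable def lieIncrement (W : ℝ≥0 → Ω → skewAdjoint (Matrix n n ℂ)) (ℓ : ℕ) (δ : ℝ≥0)
    (ω : Ω) : Matrix n n ℂ :=
  (δ : ℝ)⁻¹ • ((W ((ℓ + 1) * δ) ω : Matrix n n ℂ) - (W (ℓ * δ) ω : Matrix n n ℂ))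

/-- The ordered product
`exp(W_{mδ} - W_{(m-1)δ}) ⋯ exp(W_{2δ} - W_δ) exp(W_δ - W_0)`, later times to the left. -/
noncomputable def stepProduct (W : ℝ≥0 → Ω → skewAdjoint (Matrix n n ℂ)) (δ : ℝ≥0) (ω : Ω) :
    ℕ → Matrix n n ℂ
  | 0 => 1
  | m + 1 => NormedSpace.exp
      ((W ((m + 1) * δ) ω : Matrix n n ℂ) - (W (m * δ) ω : Matrix n n ℂ)) * stepProduct W δ ω m

/-- `U` is the product integral of `W`: for every `t`, the products over the `m` time steps of
length `δ = t / m`, applied to `U_0`, converge to `U_t` in probability as `m → ∞`. -/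
def IsProductIntegral (U : ℝ≥0 → Ω → Matrix.unitaryGroup n ℂ)
    (W : ℝ≥0 → Ω → skewAdjoint (Matrix n n ℂ)) (P : Measure Ω) : Prop :=
  ∀ t : ℝ≥0, TendstoInMeasure P
    (fun (m : ℕ) ω => stepProduct W (t / m) ω m * (U 0 ω : Matrix n n ℂ)) atTop
    (fun ω => (U t ω : Matrix n n ℂ))

/-- The averaged state `ρ(t) = 𝔼[U_t ρ U_t†]`. -/
noncomputable def averagedState (U : ℝ≥0 → Ω → Matrix.unitaryGroup n ℂ) (P : Measure Ω)
    (ρ : Matrix n n ℂ) (t : ℝ≥0) : Matrix n n ℂ :=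
  ∫ ω, (U t ω : Matrix n n ℂ) * ρ * (U t ω : Matrix n n ℂ)ᴴ ∂P

end Processes

/-- A quantum dynamical semigroup on the `n × n` matrices: a continuous one-parameter semigroup of
completely positive trace-preserving linear maps. -/
structure IsQuantumDynamicalSemigroup {n : Type*} [Fintype n] [DecidableEq n]
    (T : ℝ≥0 → (Matrix n n ℂ →CP Matrix n n ℂ)) : Prop where
  zero : ∀ ρ, T 0 ρ = ρ
  add : ∀ s t ρ, T (s + t) ρ = T s (T t ρ)
  trace_preserving : ∀ t ρ, (T t ρ).trace = ρ.trace
  continuous : ∀ ρ, Continuous fun t => T t ρ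

/-- The Lindblad generator with Hamiltonian `H₀` and jump operators `B μ`, all at rate `a`:
`ρ ↦ -i[H₀, ρ] + a ∑_μ (B_μ ρ B_μ† - ½ (B_μ† B_μ ρ + ρ B_μ† B_μ))`. -/
noncomputable def lindbladGenerator {n ι : Type*} [Fintype n] [Fintype ι]
    (H₀ : Matrix n n ℂ) (B : ι → Matrix n n ℂ) (a : ℝ) (ρ : Matrix n n ℂ) : Matrix n n ℂ :=
  (-Complex.I) • (H₀ * ρ - ρ * H₀) +
    a • ∑ μ, (B μ * ρ * (B μ)ᴴ - (1 / 2 : ℝ) • ((B μ)ᴴ * B μ * ρ + ρ * ((B μ)ᴴ * B μ)))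

/-! Let `L ρ = [A, ρ] + (a/2) ∑ [B_μ, [B_μ, ρ]]` with `A = -i H₀`; for anti-Hermitian `B_μ` this is
the Lindblad generator. The whole theorem follows from `E[U_t ρ U_t†] = exp(tL) ρ`
(`averagedState_eq_exp`), together with the fact that an average of unitary conjugations is
completely positive and preserves the trace.

For an increment `X` over a step `δ`, expand `exp(X) ρ exp(X)†` to second order. The noise
covariance `a/δ` makes the mean of the quadratic term contribute at order `δ`, so the mean
conjugation is `1 + δL + O(δ²)` plus a Taylor remainder (`exists_norm_integral_conjCLM_exp_sub_le`).
Independence turns the mean over `m` steps into a composition of contractions, so the one-step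
errors merely add up (`norm_integral_stepProduct_conj_sub_le`).

The delicate point is the remainder, since only second moments are available. Unitarity bounds it by
`cappedCube ‖X‖` instead of `‖X‖³`, and the sum of these means over a mesh tends to `0`. This is
Lindeberg's condition, and it comes from path continuity: the probability of any large increment
vanishes with the mesh, and `sum_setIntegral_sq_le` converts this into smallness of the second
moments carried by large increments.

The step products thus have mean conjugations converging to `exp(tL)`; convergence in probability
and dominated convergence transfer this to `U_t`. -/

/-! ### Second moments of the large summands in an independent row -/

section Lindeberg

variable {Ω : Type*} [MeasurableSpace Ω] {P : Measure Ω}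

/-- Truncation of a real number at level `ε`. -/
noncomputable def truncate (ε x : ℝ) : ℝ := if |x| ≤ ε then x else 0

lemma measurable_truncate (ε : ℝ) : Measurable (truncate ε) :=
  Measurable.ite (measurableSet_le continuous_abs.measurable measurable_const)
    measurable_id measurable_const

lemma abs_truncate_le_abs (ε x : ℝ) : |truncate ε x| ≤ |x| := by
  unfold truncate; split_ifs <;> simp

lemma abs_sub_truncate_le {ε : ℝ} (hε : 0 < ε) (x : ℝ) : |x - truncate ε x| ≤ x ^ 2 / ε := by
  unfold truncate
  split_ifs with h
  · simp; positivity
  · rw [le_div_iff₀ hε, sub_zero, ← sq_abs]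
    nlinarith [abs_nonneg x]

lemma MeasureTheory.MemLp.truncate {X : Ω → ℝ} (hX : MemLp X 2 P) (ε : ℝ) :
    MemLp (fun ω => truncate ε (X ω)) 2 P :=
  hX.of_le ((measurable_truncate ε).comp_aemeasurable hX.1.aemeasurable).aestronglyMeasurable
    (.of_forall fun _ => abs_truncate_le_abs _ _)

lemma integral_sq_truncate {X : Ω → ℝ} (hXm : Measurable X) (hX : MemLp X 2 P) (ε : ℝ) :
    ∫ ω, truncate ε (X ω) ^ 2 ∂P =
      ∫ ω, X ω ^ 2 ∂P - ∫ ω in {ω | ε < |X ω|}, X ω ^ 2 ∂P := by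
  have hm : MeasurableSet {ω | ε < |X ω|} := measurableSet_lt measurable_const hXm.abs
  rw [← integral_add_compl hm hX.integrable_sq, add_sub_cancel_left, ← integral_indicator hm.compl]
  congr with ω
  by_cases h : |X ω| ≤ ε <;> simp [truncate, Set.indicator, h]

lemma sum_integral_sq_eq_variance_add [IsProbabilityMeasure P] {ι : Type*} (s : Finset ι)
    {X : ι → Ω → ℝ} (hX : ∀ i ∈ s, MemLp (X i) 2 P) (hind : iIndepFun X P) :
    ∑ i ∈ s, ∫ ω, X i ω ^ 2 ∂P =
      variance (∑ i ∈ s, X i) P + ∑ i ∈ s, (∫ ω, X i ω ∂P) ^ 2 := by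
  rw [IndepFun.variance_sum hX fun i _ j _ hij => hind.indepFun hij, ← Finset.sum_add_distrib]
  refine Finset.sum_congr rfl fun i hi => ?_
  rw [variance_eq_sub (hX i hi)]
  simp

/-- For an independent row with sum `S`, the second moments of the large summands are controlled by
the event `A` that there is a large summand. -/
lemma sum_setIntegral_sq_le [IsProbabilityMeasure P] {ι : Type*} (s : Finset ι) {X : ι → Ω → ℝ}
    (hXm : ∀ i, Measurable (X i)) (hX : ∀ i ∈ s, MemLp (X i) 2 P) (hind : iIndepFun X P)
    {S : Ω → ℝ} (hS : ∀ ω, S ω = ∑ i ∈ s, X i ω) {ε : ℝ} (hε : 0 < ε) :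
    ∑ i ∈ s, ∫ ω in {ω | ε < |X i ω|}, X i ω ^ 2 ∂P ≤
      2 * ∫ ω in {ω | ∃ i ∈ s, ε < |X i ω|}, S ω ^ 2 ∂P +
      2 * (|∫ ω, S ω ∂P| + (variance S P + ∑ i ∈ s, (∫ ω, X i ω ∂P) ^ 2) / ε) ^ 2 *
        P.real {ω | ∃ i ∈ s, ε < |X i ω|} +
      ∑ i ∈ s, (∫ ω, X i ω ∂P) ^ 2 := by
  obtain rfl : S = ∑ i ∈ s, X i := by ext ω; simp [hS]
  set S := ∑ i ∈ s, X i
  set A := {ω | ∃ i ∈ s, ε < |X i ω|}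
  have hA : MeasurableSet A := by
    have : A = ⋃ i ∈ s, {ω | ε < |X i ω|} := by ext; simp [A]
    rw [this]
    exact s.measurableSet_biUnion fun i _ => measurableSet_lt measurable_const (hXm i).abs
  have hSL : MemLp S 2 P := memLp_finsetSum' s hX
  -- The truncated sum `T` equals `S` off `A`, so its variance can fall short of that of `S` only
  -- through what happens on `A`; by independence that shortfall controls the second moments removed
  -- by truncation.
  set Y : ι → Ω → ℝ := fun i ω => truncate ε (X i ω)
  have hY : ∀ i ∈ s, MemLp (Y i) 2 P := fun i hi => (hX i hi).truncate ε
  have hYind : iIndepFun Y P := hind.comp _ fun _ => measurable_truncate ε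
  set T := ∑ i ∈ s, Y i
  have hTL : MemLp T 2 P := memLp_finsetSum' s hY
  set c := ∫ ω, T ω ∂P
  have hsumX := sum_integral_sq_eq_variance_add s hX hind
  have hsumY := sum_integral_sq_eq_variance_add s hY hYind
  have htr : ∑ i ∈ s, ∫ ω, Y i ω ^ 2 ∂P = ∑ i ∈ s, ∫ ω, X i ω ^ 2 ∂P -
      ∑ i ∈ s, ∫ ω in {ω | ε < |X i ω|}, X i ω ^ 2 ∂P := by
    rw [← Finset.sum_sub_distrib]
    exact Finset.sum_congr rfl fun i hi => integral_sq_truncate (hXm i) (hX i hi) ε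
  -- Truncation shifts each mean by at most `E[X_i²] / ε`, which keeps the centre `c` bounded in
  -- terms of `S` and the means alone.
  have hc : |c| ≤ |∫ ω, S ω ∂P| + (variance S P + ∑ i ∈ s, (∫ ω, X i ω ∂P) ^ 2) / ε := by
    have h1 : ∫ ω, S ω ∂P - c = ∑ i ∈ s, ∫ ω, (X i ω - Y i ω) ∂P := by
      simp only [c, S, T, Finset.sum_apply]
      rw [integral_finsetSum _ fun i hi => (hX i hi).integrable one_le_two,
        integral_finsetSum _ fun i hi => (hY i hi).integrable one_le_two, ← Finset.sum_sub_distrib]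
      exact Finset.sum_congr rfl fun i hi =>
        (integral_sub ((hX i hi).integrable one_le_two) ((hY i hi).integrable one_le_two)).symm
    have h2 : |∫ ω, S ω ∂P - c| ≤ (∑ i ∈ s, ∫ ω, X i ω ^ 2 ∂P) / ε := by
      rw [h1, Finset.sum_div]
      refine (Finset.abs_sum_le_sum_abs _ _).trans (Finset.sum_le_sum fun i hi => ?_)
      rw [← integral_div]
      exact norm_integral_le_of_norm_le (f := fun ω => X i ω - Y i ω)
        ((hX i hi).integrable_sq.div_const ε) (.of_forall fun ω => abs_sub_truncate_le hε (X i ω))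
    rw [← hsumX]
    have := abs_sub_abs_le_abs_sub c (∫ ω, S ω ∂P)
    rw [abs_sub_comm] at this
    linarith
  have hSc : Integrable (fun ω => (S ω - c) ^ 2) P := (hSL.sub (memLp_const c)).integrable_sq
  have hTc : Integrable (fun ω => (T ω - c) ^ 2) P := (hTL.sub (memLp_const c)).integrable_sq
  have hvT : variance T P = ∫ ω, (T ω - c) ^ 2 ∂P := variance_eq_integral hTL.1.aemeasurable
  -- The variance is the least mean square deviation, so `S` may be centred at `c`, the mean of `T`.
  have hvS : variance S P ≤ ∫ ω, (S ω - c) ^ 2 ∂P := by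
    have h := variance_le_expectation_sq (μ := P) (X := fun ω => S ω - c)
      (hSL.sub (memLp_const c)).1
    rwa [variance_sub_const hSL.1] at h
  have hcompl : ∫ ω in Aᶜ, (T ω - c) ^ 2 ∂P = ∫ ω in Aᶜ, (S ω - c) ^ 2 ∂P := by
    refine setIntegral_congr_fun hA.compl fun ω hω => ?_
    have : T ω = S ω := by
      simp only [T, S, Finset.sum_apply]
      refine Finset.sum_congr rfl fun i hi => ?_
      have : |X i ω| ≤ ε := by
        by_contra! h
        exact hω ⟨i, hi, h⟩
      simp [Y, truncate, this]
    simp only [this]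
  have hTge : ∫ ω in Aᶜ, (T ω - c) ^ 2 ∂P ≤ ∫ ω, (T ω - c) ^ 2 ∂P :=
    setIntegral_le_integral hTc (.of_forall fun _ => sq_nonneg _)
  have hsplit := integral_add_compl hA hSc
  have hAle : ∫ ω in A, (S ω - c) ^ 2 ∂P ≤
      2 * ∫ ω in A, S ω ^ 2 ∂P + 2 * c ^ 2 * P.real A := by
    have : 2 * ∫ ω in A, S ω ^ 2 ∂P + 2 * c ^ 2 * P.real A =
        ∫ ω in A, (2 * S ω ^ 2 + 2 * c ^ 2) ∂P := by
      rw [integral_add (hSL.integrable_sq.integrableOn.const_mul 2) (integrable_const _),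
        integral_const_mul]
      simp [mul_comm]
    rw [this]
    refine setIntegral_mono hSc.integrableOn
      ((hSL.integrable_sq.const_mul 2).add (integrable_const _)).integrableOn fun ω => ?_
    simp only
    nlinarith [sq_nonneg (S ω + c)]
  have hcK : c ^ 2 * P.real A ≤ (|∫ ω, S ω ∂P| +
      (variance S P + ∑ i ∈ s, (∫ ω, X i ω ∂P) ^ 2) / ε) ^ 2 * P.real A := by
    rw [← sq_abs c]
    gcongr
  have hYnn : 0 ≤ ∑ i ∈ s, (∫ ω, Y i ω ∂P) ^ 2 := Finset.sum_nonneg fun _ _ => sq_nonneg _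
  have hYle : ∑ i ∈ s, ∫ ω, Y i ω ^ 2 ∂P ≥ variance T P := by linarith
  linarith

end Lindeberg

/-! ### The gauge for the Taylor remainder -/

section CappedCube

/-- The function `s ↦ s² min(1, s)`, quadratic at infinity and cubic at the origin. -/
noncomputable def cappedCube (s : ℝ) : ℝ := s ^ 2 * min 1 s

lemma cappedCube_nonneg {s : ℝ} (hs : 0 ≤ s) : 0 ≤ cappedCube s := by
  unfold cappedCube; positivity

lemma cappedCube_le_sq (s : ℝ) : cappedCube s ≤ s ^ 2 :=
  mul_le_of_le_one_right (sq_nonneg s) (min_le_left _ _)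

lemma cappedCube_mono {s u : ℝ} (hs : 0 ≤ s) (h : s ≤ u) : cappedCube s ≤ cappedCube u := by
  unfold cappedCube; gcongr

lemma cappedCube_mul_le {D s : ℝ} (hD : 1 ≤ D) :
    cappedCube (D * s) ≤ D ^ 3 * cappedCube s := by
  have h : min 1 (D * s) ≤ D * min 1 s := by
    rw [mul_min_of_nonneg _ _ (by linarith)]
    exact min_le_min (by linarith) le_rfl
  calc cappedCube (D * s) = D ^ 2 * s ^ 2 * min 1 (D * s) := by unfold cappedCube; ring
    _ ≤ D ^ 2 * s ^ 2 * (D * min 1 s) := by gcongr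
    _ = D ^ 3 * cappedCube s := by unfold cappedCube; ring

lemma continuous_cappedCube : Continuous cappedCube := by
  unfold cappedCube; fun_prop

/-- Below the threshold the factor `min 1 |x|` is at most `ε`; above it the cap leaves `x²`. This
reduces the capped-cube sums to total variance times `ε` plus the large-increment part. -/
lemma cappedCube_abs_le {ε : ℝ} (hε : 0 ≤ ε) (x : ℝ) :
    cappedCube |x| ≤ ε * x ^ 2 + {y : ℝ | ε < |y|}.indicator (fun y => y ^ 2) x := by
  by_cases h : ε < |x|
  · simp only [Set.indicator, Set.mem_ofPred_eq, h, if_true]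
    nlinarith [cappedCube_le_sq |x|, sq_abs x, sq_nonneg x, mul_nonneg hε (sq_nonneg x)]
  · have h1 : min 1 |x| ≤ ε := (min_le_right _ _).trans (not_lt.mp h)
    simp only [cappedCube, sq_abs, Set.indicator, Set.mem_ofPred_eq, h, if_false, add_zero]
    nlinarith [sq_nonneg x]

variable {Ω : Type*} [MeasurableSpace Ω] {P : Measure Ω}

lemma integrable_cappedCube_norm {E : Type*} [NormedAddCommGroup E] {X : Ω → E}
    (hX : MemLp X 2 P) : Integrable (fun ω => cappedCube ‖X ω‖) P :=
  hX.norm.integrable_sq.mono'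
    (continuous_cappedCube.comp_aestronglyMeasurable hX.1.norm)
    (.of_forall fun ω => by
      rw [Real.norm_of_nonneg (cappedCube_nonneg (norm_nonneg _))]
      exact cappedCube_le_sq _)

end CappedCube

/-! ### Increments of a path along a uniform mesh -/

section Paths

variable {Ω : Type*}

/-- The increment of a process over the `ℓ`-th time step of length `δ`. -/
def stepIncrement {E : Type*} [Sub E] (Y : ℝ≥0 → Ω → E) (δ : ℝ≥0) (ℓ : ℕ) (ω : Ω) : E :=
  Y ((ℓ + 1) * δ) ω - Y (ℓ * δ) ω

lemma sum_stepIncrement {E : Type*} [AddCommGroup E] (Y : ℝ≥0 → Ω → E) (t : ℝ≥0) {m : ℕ}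
    (hm : m ≠ 0) (ω : Ω) :
    ∑ ℓ ∈ Finset.range m, stepIncrement Y (t / m) ℓ ω = Y t ω - Y 0 ω := by
  have h := Finset.sum_range_sub (fun ℓ : ℕ => Y (ℓ * (t / m)) ω) m
  have h2 : (m : ℝ≥0) * (t / m) = t := mul_div_cancel₀ _ (by simpa)
  simpa [stepIncrement, h2] using h

/-- The largest increment of a continuous path over a mesh tends to `0` with the mesh. -/
lemma eventually_forall_abs_stepIncrement_le {Y : ℝ≥0 → Ω → ℝ} {ω : Ω}
    (hY : Continuous fun t => Y t ω) (t : ℝ≥0) {ε : ℝ} (hε : 0 < ε) :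
    ∀ᶠ m : ℕ in atTop, ∀ ℓ ∈ Finset.range m, |stepIncrement Y (t / m) ℓ ω| ≤ ε := by
  have hu : UniformContinuousOn (fun s => Y s ω) (Set.Icc 0 t) :=
    isCompact_Icc.uniformContinuousOn_of_continuous hY.continuousOn
  obtain ⟨d, hd, h⟩ := Metric.uniformContinuousOn_iff_le.mp hu ε hε
  have hlim : Tendsto (fun m : ℕ => (t : ℝ) / m) atTop (𝓝 0) :=
    tendsto_const_div_atTop_nhds_zero_nat _
  filter_upwards [hlim.eventually_le_const hd, eventually_gt_atTop 0] with m hm hm0 ℓ hℓ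
  have hm0' : (0 : ℝ≥0) < m := by exact_mod_cast hm0
  have hℓ' : (ℓ : ℝ≥0) + 1 ≤ m := by exact_mod_cast Finset.mem_range.mp hℓ
  have hle : ((ℓ : ℝ≥0) + 1) * (t / m) ≤ t := by
    calc ((ℓ : ℝ≥0) + 1) * (t / m) ≤ m * (t / m) := by gcongr
      _ = t := mul_div_cancel₀ _ hm0'.ne'
  have hle' : (ℓ : ℝ≥0) * (t / m) ≤ (ℓ + 1) * (t / m) := by gcongr; simp
  refine h _ ⟨zero_le, hle⟩ _ ⟨zero_le, hle'.trans hle⟩ ?_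
  rw [NNReal.dist_eq]
  push_cast
  rw [show ((ℓ : ℝ) + 1) * (t / m) - ℓ * (t / m) = t / m by ring, abs_of_nonneg (by positivity)]
  exact hm

end Paths

/-! ### Lindeberg's condition for real processes -/

section IndependentIncrements

variable {Ω : Type*} [MeasurableSpace Ω] {P : Measure Ω}

lemma ProbabilityTheory.HasIndepIncrements.iIndepFun_stepIncrement {E : Type*} [Sub E]
    [MeasurableSpace E] {Y : ℝ≥0 → Ω → E} (hY : HasIndepIncrements Y P) (δ : ℝ≥0) :
    iIndepFun (stepIncrement Y δ) P := by
  have h := hY.nat (t := fun i : ℕ => (i : ℝ≥0) * δ)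
    fun i j hij => mul_le_mul_left (Nat.cast_le.mpr hij) δ
  simpa only [Nat.cast_add, Nat.cast_one] using! h

/-- Lindeberg's condition holds for square-integrable processes with independent increments and
continuous paths. -/
lemma tendsto_sum_integral_cappedCube_stepIncrement [IsProbabilityMeasure P] {Y : ℝ≥0 → Ω → ℝ}
    (hYm : ∀ t, Measurable (Y t)) (hind : HasIndepIncrements Y P)
    (hcont : ∀ᵐ ω ∂P, Continuous fun t => Y t ω) (c : ℝ)
    (hL : ∀ δ : ℝ≥0, 0 < δ → ∀ ℓ, MemLp (stepIncrement Y δ ℓ) 2 P)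
    (hmean : ∀ δ : ℝ≥0, 0 < δ → ∀ ℓ, ∫ ω, stepIncrement Y δ ℓ ω ∂P = δ * c)
    {t : ℝ≥0} (ht : 0 < t) :
    Tendsto (fun m : ℕ => ∑ ℓ ∈ Finset.range m,
      ∫ ω, cappedCube |stepIncrement Y (t / m) ℓ ω| ∂P) atTop (𝓝 0) := by
  set S : Ω → ℝ := fun ω => Y t ω - Y 0 ω
  have hSL : MemLp S 2 P := by
    have h : stepIncrement Y t 0 = S := by ext; simp [stepIncrement, S]
    exact h ▸ hL t ht 0
  have hδ : ∀ m : ℕ, m ≠ 0 → 0 < t / m := fun m hm => by positivity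
  have hXm : ∀ (m : ℕ) (ℓ : ℕ), Measurable (stepIncrement Y (t / m) ℓ) :=
    fun m ℓ => (hYm _).sub (hYm _)
  set M : ℕ → ℝ := fun m =>
    ∑ ℓ ∈ Finset.range m, (∫ ω, stepIncrement Y (t / m) ℓ ω ∂P) ^ 2
  -- Each of the `m` means is `tc/m`, so their squares sum to order `1/m`.
  have hM : ∀ m : ℕ, m ≠ 0 → M m = (t * c) ^ 2 / m := fun m hm => by
    have hm' : (m : ℝ) ≠ 0 := by exact_mod_cast hm
    simp only [M, fun ℓ => hmean _ (hδ m hm) ℓ, Finset.sum_const, Finset.card_range, nsmul_eq_mul]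
    push_cast
    field_simp
  have hM0 : Tendsto M atTop (𝓝 0) :=
    (tendsto_const_div_atTop_nhds_zero_nat ((t * c) ^ 2)).congr'
      ((eventually_ne_atTop 0).mono fun m hm => (hM m hm).symm)
  set A : ℝ → ℕ → Set Ω := fun ε m => {ω | ∃ ℓ ∈ Finset.range m, ε < |stepIncrement Y (t / m) ℓ ω|}
  have hAm : ∀ ε m, MeasurableSet (A ε m) := fun ε m => by
    have : A ε m = ⋃ ℓ ∈ Finset.range m, {ω | ε < |stepIncrement Y (t / m) ℓ ω|} := by
      ext; simp [A]
    rw [this]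
    exact Finset.measurableSet_biUnion _ fun ℓ _ => measurableSet_lt measurable_const (hXm m ℓ).abs
  -- Path continuity enters here: almost every path eventually has no increment above `ε` on the
  -- mesh.
  have hA0 : ∀ ε > 0, Tendsto (fun m => P (A ε m)) atTop (𝓝 0) := fun ε hε => by
    have h := tendsto_measure_of_ae_tendsto_indicator_of_isFiniteMeasure (μ := P) (A := ∅) atTop
      MeasurableSet.empty (hAm ε) (by
        filter_upwards [hcont] with ω hω
        filter_upwards [eventually_forall_abs_stepIncrement_le hω t hε] with m hm
        simp only [Set.mem_empty_iff_false, iff_false]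
        rintro ⟨ℓ, hℓ, h⟩
        exact absurd (hm ℓ hℓ) (not_le.mpr h))
    simpa using h
  set R : ℝ → ℕ → ℝ := fun ε m => ∑ ℓ ∈ Finset.range m,
    ∫ ω in {ω | ε < |stepIncrement Y (t / m) ℓ ω|}, stepIncrement Y (t / m) ℓ ω ^ 2 ∂P
  have hR : ∀ ε > 0, Tendsto (R ε) atTop (𝓝 0) := fun ε hε => by
    have h1 : Tendsto (fun m => ∫ ω in A ε m, S ω ^ 2 ∂P) atTop (𝓝 0) :=
      hSL.integrable_sq.tendsto_setIntegral_nhds_zero (hA0 ε hε)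
    have h2 : Tendsto (fun m => P.real (A ε m)) atTop (𝓝 0) := by
      simpa using! (ENNReal.tendsto_toReal ENNReal.zero_ne_top).comp (hA0 ε hε)
    have h3 := (((tendsto_const_nhds (x := variance S P)).add hM0).div_const ε).const_add
      |∫ ω, S ω ∂P|
    have hlim := ((h1.const_mul 2).add (((h3.pow 2).const_mul 2).mul h2)).add hM0
    simp only [mul_zero, add_zero] at hlim
    refine squeeze_zero' (.of_forall fun m => Finset.sum_nonneg fun ℓ _ =>
      integral_nonneg fun ω => sq_nonneg _) ?_ hlim
    filter_upwards [eventually_ne_atTop 0] with m hm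
    exact sum_setIntegral_sq_le (Finset.range m) (hXm m) (fun ℓ _ => hL _ (hδ m hm) ℓ)
      (hind.iIndepFun_stepIncrement _) (fun ω => (sum_stepIncrement Y t hm ω).symm) hε
  have hbound : ∀ ε > 0, ∀ m : ℕ, m ≠ 0 →
      ∑ ℓ ∈ Finset.range m, ∫ ω, cappedCube |stepIncrement Y (t / m) ℓ ω| ∂P ≤
        ε * (variance S P + M m) + R ε m := fun ε hε m hm => by
    have hv := sum_integral_sq_eq_variance_add (Finset.range m)
      (fun ℓ _ => hL _ (hδ m hm) ℓ) (hind.iIndepFun_stepIncrement (t / m))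
    have hSe : ∑ ℓ ∈ Finset.range m, stepIncrement Y (t / m) ℓ = S := by
      ext ω; simp [S, sum_stepIncrement Y t hm ω]
    rw [hSe] at hv
    rw [← hv, Finset.mul_sum, ← Finset.sum_add_distrib]
    refine Finset.sum_le_sum fun ℓ _ => ?_
    have hsq := (hL _ (hδ m hm) ℓ).integrable_sq
    have hms : MeasurableSet {ω | ε < |stepIncrement Y (t / m) ℓ ω|} :=
      measurableSet_lt measurable_const (hXm m ℓ).abs
    rw [← integral_indicator hms, ← integral_const_mul,
      ← integral_add (hsq.const_mul ε) (hsq.indicator hms)]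
    exact integral_mono (integrable_cappedCube_norm (hL _ (hδ m hm) ℓ))
      ((hsq.const_mul ε).add (hsq.indicator hms)) fun ω => by
        have := cappedCube_abs_le hε.le (stepIncrement Y (t / m) ℓ ω)
        simpa [Set.indicator] using this
  refine tendsto_order.mpr ⟨fun b hb => .of_forall fun m => hb.trans_le <|
    Finset.sum_nonneg fun ℓ _ => integral_nonneg fun ω => cappedCube_nonneg (abs_nonneg _),
    fun η hη => ?_⟩
  have hV := variance_nonneg S P
  -- This threshold makes the variance term smaller than `η`; the `+ 1` covers vanishing variance.
  have hε : 0 < η / (variance S P + 1) := by positivity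
  have hlim := ((hM0.const_add (variance S P)).const_mul (η / (variance S P + 1))).add (hR _ hε)
  have hlt : η / (variance S P + 1) * (variance S P + 0) + 0 < η := by
    rw [add_zero, add_zero, div_mul_eq_mul_div, div_lt_iff₀ (by positivity)]
    linarith
  filter_upwards [hlim.eventually_lt_const hlt, eventually_ne_atTop 0] with m hm hm0
  exact (hbound _ hε m hm0).trans_lt hm

end IndependentIncrements

/-! ### Lindeberg's condition in finite dimension -/

section FiniteDimensional

/-- The largest coordinate in a basis dominates the norm up to a factor `D`, and pulling `D` out of
`cappedCube` costs `D ^ 3`. This reduces the vector case to scalar coordinate processes. -/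
lemma exists_cappedCube_norm_le_sum (E : Type*) [NormedAddCommGroup E] [NormedSpace ℝ E]
    [FiniteDimensional ℝ E] : ∃ (k : ℕ) (f : Fin k → E →L[ℝ] ℝ) (C : ℝ), 0 ≤ C ∧
      ∀ x, cappedCube ‖x‖ ≤ C * ∑ i, cappedCube |f i x| := by
  set b := Module.finBasis ℝ E
  set D : ℝ := 1 + ∑ i, ‖b i‖ with hDdef
  have hD : 1 ≤ D := le_add_of_nonneg_right (Finset.sum_nonneg fun _ _ => norm_nonneg _)
  refine ⟨_, fun i => LinearMap.toContinuousLinearMap (b.coord i), D ^ 3, by positivity,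
    fun x => ?_⟩
  simp only [LinearMap.coe_toContinuousLinearMap', Module.Basis.coord_apply]
  have hx : ‖x‖ ≤ ∑ i, |b.repr x i| * ‖b i‖ := by
    conv_lhs => rw [← b.sum_repr x]
    exact (norm_sum_le _ _).trans (Finset.sum_le_sum fun i _ => by rw [norm_smul, Real.norm_eq_abs])
  rcases isEmpty_or_nonempty (Fin (Module.finrank ℝ E)) with he | he
  · have h0 : ‖x‖ = 0 := le_antisymm (by simpa using hx) (norm_nonneg _)
    simp [h0, cappedCube]
  · obtain ⟨i, -, hi⟩ := Finset.exists_max_image Finset.univ (fun i => |b.repr x i|)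
      Finset.univ_nonempty
    have hxi : ‖x‖ ≤ D * |b.repr x i| := by
      refine hx.trans ?_
      rw [hDdef, add_mul, one_mul, Finset.sum_mul]
      refine le_add_of_nonneg_of_le (abs_nonneg _) (Finset.sum_le_sum fun j _ => ?_)
      rw [mul_comm]
      exact mul_le_mul_of_nonneg_left (hi j (Finset.mem_univ _)) (norm_nonneg _)
    calc cappedCube ‖x‖ ≤ cappedCube (D * |b.repr x i|) := cappedCube_mono (norm_nonneg _) hxi
      _ ≤ D ^ 3 * cappedCube |b.repr x i| := cappedCube_mul_le hD
      _ ≤ D ^ 3 * ∑ i, cappedCube |b.repr x i| := by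
        gcongr
        exact Finset.single_le_sum (f := fun i => cappedCube |b.repr x i|)
          (fun j _ => cappedCube_nonneg (abs_nonneg _)) (Finset.mem_univ i)

variable {Ω : Type*} [MeasurableSpace Ω] {P : Measure Ω}

/-- Lindeberg's condition for processes with values in a finite-dimensional space. -/
lemma tendsto_sum_integral_cappedCube_norm_stepIncrement [IsProbabilityMeasure P] {E : Type*}
    [NormedAddCommGroup E] [NormedSpace ℝ E] [FiniteDimensional ℝ E] [MeasurableSpace E]
    [BorelSpace E] {Y : ℝ≥0 → Ω → E}
    (hYm : ∀ t, Measurable (Y t)) (hind : HasIndepIncrements Y P)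
    (hcont : ∀ᵐ ω ∂P, Continuous fun t => Y t ω) (c : E)
    (hL : ∀ δ : ℝ≥0, 0 < δ → ∀ ℓ, MemLp (stepIncrement Y δ ℓ) 2 P)
    (hmean : ∀ δ : ℝ≥0, 0 < δ → ∀ ℓ, ∫ ω, stepIncrement Y δ ℓ ω ∂P = δ • c)
    {t : ℝ≥0} (ht : 0 < t) :
    Tendsto (fun m : ℕ => ∑ ℓ ∈ Finset.range m,
      ∫ ω, cappedCube ‖stepIncrement Y (t / m) ℓ ω‖ ∂P) atTop (𝓝 0) := by
  have : CompleteSpace E := FiniteDimensional.complete ℝ E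
  obtain ⟨k, f, C, hC, hf⟩ := exists_cappedCube_norm_le_sum E
  have hstep : ∀ i δ ℓ, stepIncrement (fun t ω => f i (Y t ω)) δ ℓ =
      fun ω => f i (stepIncrement Y δ ℓ ω) := fun i δ ℓ => by ext; simp [stepIncrement]
  have hfL : ∀ i (δ : ℝ≥0), 0 < δ → ∀ ℓ, MemLp (fun ω => f i (stepIncrement Y δ ℓ ω)) 2 P :=
    fun i δ hδ ℓ => (f i).comp_memLp' (hL δ hδ ℓ)
  have h : ∀ i, Tendsto (fun m : ℕ => ∑ ℓ ∈ Finset.range m,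
      ∫ ω, cappedCube |f i (stepIncrement Y (t / m) ℓ ω)| ∂P) atTop (𝓝 0) := fun i => by
    have h := tendsto_sum_integral_cappedCube_stepIncrement (P := P) (Y := fun t ω => f i (Y t ω))
      (fun t => (f i).measurable.comp (hYm t)) (hind.map (f i))
      (hcont.mono fun ω hω => (f i).continuous.comp hω) (f i c)
      (fun δ hδ ℓ => by rw [hstep]; exact hfL i δ hδ ℓ)
      (fun δ hδ ℓ => by
        simp only [hstep]
        rw [(f i).integral_comp_comm ((hL δ hδ ℓ).integrable one_le_two), hmean δ hδ ℓ]
        simp [NNReal.smul_def]) ht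
    simpa only [hstep] using h
  have hlim : Tendsto (fun m : ℕ => C * ∑ i, ∑ ℓ ∈ Finset.range m,
      ∫ ω, cappedCube |f i (stepIncrement Y (t / m) ℓ ω)| ∂P) atTop (𝓝 0) := by
    simpa using (tendsto_finsetSum _ fun i _ => h i).const_mul C
  refine squeeze_zero' (.of_forall fun m => Finset.sum_nonneg fun ℓ _ =>
      integral_nonneg fun ω => cappedCube_nonneg (norm_nonneg _)) ?_ hlim
  filter_upwards [eventually_ne_atTop 0] with m hm
  have hδ : 0 < t / m := by positivity
  rw [Finset.sum_comm, Finset.mul_sum]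
  refine Finset.sum_le_sum fun ℓ _ => ?_
  have hint : ∀ i, Integrable (fun ω => cappedCube |f i (stepIncrement Y (t / m) ℓ ω)|) P :=
    fun i => integrable_cappedCube_norm (hfL i _ hδ ℓ)
  rw [← integral_finsetSum _ fun i _ => hint i, ← integral_const_mul]
  exact integral_mono (integrable_cappedCube_norm (hL _ hδ ℓ))
    ((integrable_finsetSum _ fun i _ => hint i).const_mul C) fun ω => hf _

end FiniteDimensional

/-! ### Second-order expansion of unitary conjugation -/

section Taylor

variable {𝔸 : Type*} [CStarAlgebra 𝔸]

lemma exp_mem_unitary_of_skewAdjoint {X : 𝔸} (hX : X ∈ skewAdjoint 𝔸) :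
    NormedSpace.exp X ∈ unitary 𝔸 := by
  let _ : NormedAlgebra ℚ 𝔸 := .restrictScalars ℚ ℂ 𝔸
  exact NormedSpace.exp_mem_unitary_of_mem_skewAdjoint hX

lemma star_exp_of_mem_skewAdjoint {X : 𝔸} (hX : X ∈ skewAdjoint 𝔸) :
    star (NormedSpace.exp X) = NormedSpace.exp (-X) := by
  let _ : NormedAlgebra ℚ 𝔸 := .restrictScalars ℚ ℂ 𝔸
  rw [NormedSpace.star_exp, skewAdjoint.mem_iff.mp hX]

lemma continuous_exp_of_cStarAlgebra : Continuous (NormedSpace.exp : 𝔸 → 𝔸) := by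
  let _ : NormedAlgebra ℚ 𝔸 := .restrictScalars ℚ ℂ 𝔸
  exact NormedSpace.exp_continuous

lemma norm_unitary_conj_eq {V : 𝔸} (hV : V ∈ unitary 𝔸) (ρ : 𝔸) : ‖V * ρ * star V‖ = ‖ρ‖ := by
  rw [CStarRing.norm_mul_mem_unitary _ (Unitary.star_mem hV), CStarRing.norm_mem_unitary_mul _ hV]

lemma norm_lie_le (X ρ : 𝔸) : ‖⁅X, ρ⁆‖ ≤ 2 * (‖X‖ * ‖ρ‖) := by
  rw [Ring.lie_def]
  have h1 := norm_mul_le X ρ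
  have h2 := norm_mul_le ρ X
  linarith [norm_sub_le (X * ρ) (ρ * X), mul_comm ‖X‖ ‖ρ‖]

/-- This is the local remainder estimate of the exponential series. Taking `r ≤ 1` ensures that
`cappedCube` is the plain cube on this ball. -/
lemma exists_norm_exp_sub_le (𝔸 : Type*) [CStarAlgebra 𝔸] :
    ∃ r C : ℝ, 0 < r ∧ r ≤ 1 ∧ 0 ≤ C ∧ ∀ X : 𝔸, ‖X‖ < r →
      ‖NormedSpace.exp X - (1 + X + (1 / 2 : ℝ) • (X * X))‖ ≤ C * ‖X‖ ^ 3 := by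
  have h := (NormedSpace.exp_hasFPowerSeriesAt_zero (𝕂 := ℂ) (𝔸 := 𝔸)).isBigO_sub_partialSum_pow 3
  obtain ⟨C, hC, h⟩ := h.exists_nonneg
  obtain ⟨r, hr, h⟩ := Metric.eventually_nhds_iff.mp h.bound
  refine ⟨min r 1, C, by positivity, min_le_right _ _, hC, fun X hX => ?_⟩
  have h := h (y := X) (by simpa using hX.trans_le (min_le_left _ _))
  have hps : (NormedSpace.expSeries ℂ 𝔸).partialSum 3 X = 1 + X + (1 / 2 : ℝ) • (X * X) := by
    simp [FormalMultilinearSeries.partialSum, Finset.sum_range_succ,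
      NormedSpace.expSeries_apply_eq, pow_two]
    rw [show (2 : ℂ)⁻¹ = ((2⁻¹ : ℝ) : ℂ) by simp, Complex.coe_smul]
  simpa [hps] using h

/-- Second-order expansion of the conjugation by `exp X`, for anti-Hermitian `X`. -/
lemma exists_norm_exp_conj_sub_le (𝔸 : Type*) [CStarAlgebra 𝔸] :
    ∃ C : ℝ, 0 ≤ C ∧ ∀ X ∈ skewAdjoint 𝔸, ∀ ρ : 𝔸,
      ‖NormedSpace.exp X * ρ * star (NormedSpace.exp X) -
        (ρ + ⁅X, ρ⁆ + (1 / 2 : ℝ) • ⁅X, ⁅X, ρ⁆⁆)‖ ≤ C * cappedCube ‖X‖ * ‖ρ‖ := by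
  obtain ⟨r, C, hr, hr1, hC, h⟩ := exists_norm_exp_sub_le 𝔸
  -- For `‖X‖ < r`: `2C + C²` pays for the terms with exponential remainders, and `2` for the cubic
  -- and quartic terms (`1/2 + 1/2 + 1/4`). The summand `6 / r³` handles `‖X‖ ≥ r`.
  refine ⟨2 * C + C ^ 2 + 2 + 6 / r ^ 3, by positivity, fun X hX ρ => ?_⟩
  set e := NormedSpace.exp X
  have he : e ∈ unitary 𝔸 := exp_mem_unitary_of_skewAdjoint hX
  have hcc := cappedCube_nonneg (norm_nonneg X)
  have hl1 := norm_lie_le X ρ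
  have hl2 := norm_lie_le X ⁅X, ρ⁆
  have hx := norm_nonneg X
  have hρ := norm_nonneg ρ
  rcases lt_or_ge ‖X‖ r with hlt | hge
  · have hccX : cappedCube ‖X‖ = ‖X‖ ^ 3 := by
      rw [cappedCube, min_eq_right (hlt.le.trans hr1)]; ring
    set R := e - (1 + X + (1 / 2 : ℝ) • (X * X)) with hRdef
    set R' := star e - (1 - X + (1 / 2 : ℝ) • (X * X)) with hRdef'
    have hR : ‖R‖ ≤ C * ‖X‖ ^ 3 := h X hlt
    have hR' : ‖R'‖ ≤ C * ‖X‖ ^ 3 := by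
      have := h (-X) (by simpa using hlt)
      rw [← star_exp_of_mem_skewAdjoint hX] at this
      simpa [hRdef', sub_eq_add_neg] using this
    -- With `e = p + R` and `star e = q + R'`, one has `eρe* - pρq = Rρe* + eρR' - RρR'`; the last
    -- bracket is the part of `pρq` of degree above two. Keeping `e` itself in the first two terms
    -- allows unitarity to remove it from the norms.
    have hdec : e * ρ * star e - (ρ + ⁅X, ρ⁆ + (1 / 2 : ℝ) • ⁅X, ⁅X, ρ⁆⁆) =
        R * ρ * star e + e * ρ * R' - R * ρ * R' + ((1 / 2 : ℝ) • (X * ρ * X * X)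
          - (1 / 2 : ℝ) • (X * X * ρ * X) + (1 / 4 : ℝ) • (X * X * ρ * X * X)) := by
      simp only [hRdef, hRdef', Ring.lie_def]
      simp only [mul_add, add_mul, mul_sub, sub_mul, smul_mul_assoc, mul_smul_comm, smul_add,
        smul_sub, smul_smul, mul_one, one_mul, mul_assoc]
      module
    have h1 : ‖R * ρ * star e‖ ≤ C * ‖X‖ ^ 3 * ‖ρ‖ := by
      rw [CStarRing.norm_mul_mem_unitary _ (Unitary.star_mem he)]
      exact (norm_mul_le _ _).trans (by gcongr)
    have h2 : ‖e * ρ * R'‖ ≤ C * ‖X‖ ^ 3 * ‖ρ‖ := by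
      rw [mul_assoc, CStarRing.norm_mem_unitary_mul _ he]
      refine (norm_mul_le _ _).trans ?_
      rw [mul_comm]
      gcongr
    have h3 : ‖R * ρ * R'‖ ≤ C ^ 2 * ‖X‖ ^ 3 * ‖ρ‖ := by
      have hx3 : ‖X‖ ^ 3 ≤ 1 := pow_le_one₀ hx (hlt.le.trans hr1)
      calc ‖R * ρ * R'‖ ≤ ‖R‖ * ‖ρ‖ * ‖R'‖ := norm_mul₃_le
        _ ≤ (C * ‖X‖ ^ 3) * ‖ρ‖ * (C * 1) := by
          gcongr
          exact hR'.trans (by gcongr)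
        _ = C ^ 2 * ‖X‖ ^ 3 * ‖ρ‖ := by ring
    have h4 : ‖X * ρ * X * X‖ ≤ ‖X‖ ^ 3 * ‖ρ‖ := by
      refine (norm_mul_le _ _).trans ?_
      calc ‖X * ρ * X‖ * ‖X‖ ≤ ‖X‖ * ‖ρ‖ * ‖X‖ * ‖X‖ := by gcongr; exact norm_mul₃_le
        _ = ‖X‖ ^ 3 * ‖ρ‖ := by ring
    have h5 : ‖X * X * ρ * X‖ ≤ ‖X‖ ^ 3 * ‖ρ‖ := by
      refine (norm_mul_le _ _).trans ?_
      calc ‖X * X * ρ‖ * ‖X‖ ≤ ‖X‖ * ‖X‖ * ‖ρ‖ * ‖X‖ := by gcongr; exact norm_mul₃_le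
        _ = ‖X‖ ^ 3 * ‖ρ‖ := by ring
    have h6 : ‖X * X * ρ * X * X‖ ≤ ‖X‖ ^ 3 * ‖ρ‖ := by
      refine (norm_mul_le _ _).trans ?_
      calc ‖X * X * ρ * X‖ * ‖X‖ ≤ ‖X‖ ^ 3 * ‖ρ‖ * 1 := by
            gcongr; exact hlt.le.trans hr1
        _ = ‖X‖ ^ 3 * ‖ρ‖ := mul_one _
    rw [hdec, hccX]
    have hr3 : 0 ≤ 6 / r ^ 3 * (‖X‖ ^ 3 * ‖ρ‖) := by positivity
    calc _ ≤ ‖R * ρ * star e‖ + ‖e * ρ * R'‖ + ‖R * ρ * R'‖ +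
          (1 / 2 * ‖X * ρ * X * X‖ + 1 / 2 * ‖X * X * ρ * X‖ + 1 / 4 * ‖X * X * ρ * X * X‖) := by
          refine (norm_add_le _ _).trans (add_le_add ?_ ?_)
          · exact (norm_sub_le _ _).trans (add_le_add_left (norm_add_le _ _) _)
          · refine (norm_add_le _ _).trans (add_le_add ((norm_sub_le _ _).trans ?_) ?_) <;>
              simp [norm_smul]
      _ ≤ _ := by nlinarith [mul_nonneg (pow_nonneg hx 3) hρ]
  -- Away from the origin no cancellation is needed: conjugation is isometric and the polynomial is
  -- quadratic, while `cappedCube` is at least `r‖X‖²`.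
  · have hccX : r * ‖X‖ ^ 2 ≤ cappedCube ‖X‖ := by
      rw [cappedCube, mul_comm]
      gcongr
      exact le_min hr1 hge
    have h0 : ‖e * ρ * star e‖ = ‖ρ‖ := norm_unitary_conj_eq he ρ
    have hsq : 2 + 2 * ‖X‖ + 2 * ‖X‖ ^ 2 ≤ 6 / r ^ 3 * cappedCube ‖X‖ := by
      have h1 : 1 ≤ ‖X‖ / r := (one_le_div hr).mpr hge
      have h2 : 1 ≤ 1 / r := (one_le_div hr).mpr hr1
      have hy : ‖X‖ ≤ ‖X‖ / r := by rw [le_div_iff₀ hr]; nlinarith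
      calc 2 + 2 * ‖X‖ + 2 * ‖X‖ ^ 2 ≤ 6 * (‖X‖ / r) ^ 2 := by nlinarith
        _ = 6 / r ^ 3 * (r * ‖X‖ ^ 2) := by field_simp
        _ ≤ 6 / r ^ 3 * cappedCube ‖X‖ := by gcongr
    calc _ ≤ ‖e * ρ * star e‖ + (‖ρ‖ + ‖⁅X, ρ⁆‖ + 1 / 2 * ‖⁅X, ⁅X, ρ⁆⁆‖) := by
          refine (norm_sub_le _ _).trans (add_le_add le_rfl ((norm_add_le _ _).trans ?_))
          refine add_le_add (norm_add_le _ _) ?_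
          simp [norm_smul]
      _ ≤ (2 + 2 * ‖X‖ + 2 * ‖X‖ ^ 2) * ‖ρ‖ := by
          have : ‖X‖ * ‖⁅X, ρ⁆‖ ≤ ‖X‖ * (2 * (‖X‖ * ‖ρ‖)) := by gcongr
          rw [h0]
          nlinarith
      _ ≤ 6 / r ^ 3 * cappedCube ‖X‖ * ‖ρ‖ := by gcongr
      _ ≤ _ := by
          gcongr
          have : 0 ≤ 2 * C + C ^ 2 + 2 := by positivity
          linarith

end Taylor

/-! ### First and second moments of an increment -/

section Moments

variable {Ω : Type*} [MeasurableSpace Ω] {P : Measure Ω} [IsProbabilityMeasure P]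
  {E F ι : Type*} [NormedAddCommGroup E] [NormedSpace ℝ E] [NormedAddCommGroup F] [NormedSpace ℝ F]
  [CompleteSpace F] [Fintype ι] {A : E} {B : ι → E} {ξ : ι → Ω → ℝ} {X : Ω → E} {δ : ℝ}

lemma memLp_of_ae_eq_smul_add_sum (hξ : ∀ μ, MemLp (ξ μ) 2 P)
    (hX : ∀ᵐ ω ∂P, X ω = δ • (A + ∑ μ, ξ μ ω • B μ)) : MemLp X 2 P := by
  have h : MemLp (fun ω => δ • (A + ∑ μ, ξ μ ω • B μ)) 2 P := by
    have h1 : MemLp (fun ω => ∑ μ, ξ μ ω • B μ) 2 P := memLp_finsetSum _ fun μ _ => by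
      simpa using! (ContinuousLinearMap.toSpanSingleton ℝ (B μ)).comp_memLp' (hξ μ)
    exact ((memLp_const A).add h1).const_smul δ
  exact h.ae_eq (hX.mono fun _ => Eq.symm)

lemma integral_linearMap_of_ae_eq_smul_add_sum (hξ : ∀ μ, MemLp (ξ μ) 2 P)
    (hmean : ∀ μ, ∫ ω, ξ μ ω ∂P = 0)
    (hX : ∀ᵐ ω ∂P, X ω = δ • (A + ∑ μ, ξ μ ω • B μ)) (f : E →ₗ[ℝ] F) :
    ∫ ω, f (X ω) ∂P = δ • f A := by
  have h : (fun ω => f (X ω)) =ᵐ[P] fun ω => δ • (f A + ∑ μ, ξ μ ω • f (B μ)) :=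
    hX.mono fun ω hω => by simp [hω]
  have hi : ∀ μ, Integrable (fun ω => ξ μ ω • f (B μ)) P :=
    fun μ => ((hξ μ).integrable one_le_two).smul_const _
  rw [integral_congr_ae h, integral_smul,
    integral_add (integrable_const _) (integrable_finsetSum _ fun μ _ => hi μ),
    integral_finsetSum _ fun μ _ => hi μ]
  simp [integral_smul_const, hmean]

/-- Mixed drift-noise terms vanish by centring and off-diagonal noise terms by the covariance. With
`v = a / δ` the diagonal part has weight `δ a`, the Itô correction of first order, whereas the drift
squared keeps weight `δ²`. -/
lemma integral_bilinear_of_ae_eq_smul_add_sum [DecidableEq ι] {v : ℝ}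
    (hξ : ∀ μ, MemLp (ξ μ) 2 P) (hmean : ∀ μ, ∫ ω, ξ μ ω ∂P = 0)
    (hcov : ∀ μ ν, ∫ ω, ξ μ ω * ξ ν ω ∂P = if μ = ν then v else 0)
    (hX : ∀ᵐ ω ∂P, X ω = δ • (A + ∑ μ, ξ μ ω • B μ)) (b : E →ₗ[ℝ] E →ₗ[ℝ] F) :
    ∫ ω, b (X ω) (X ω) ∂P = δ ^ 2 • (b A A + v • ∑ μ, b (B μ) (B μ)) := by
  have h : (fun ω => b (X ω) (X ω)) =ᵐ[P] fun ω => δ ^ 2 • (b A A +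
      ((∑ μ, ξ μ ω • (b A (B μ) + b (B μ) A)) +
        ∑ μ, ∑ ν, (ξ μ ω * ξ ν ω) • b (B μ) (B ν))) :=
    hX.mono fun ω hω => by
      simp only [hω, map_smul, map_add, map_sum, LinearMap.smul_apply, LinearMap.add_apply,
        LinearMap.sum_apply, smul_smul, ← pow_two, smul_add, Finset.sum_add_distrib,
        Finset.smul_sum, mul_assoc]
      rw [Finset.sum_comm (f := fun μ ν => (δ * (ξ μ ω * (δ * ξ ν ω))) • b (B ν) (B μ))]
      simp only [show ∀ μ, δ * (δ * ξ μ ω) = δ ^ 2 * ξ μ ω from fun μ => by ring,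
        show ∀ μ, δ * (ξ μ ω * δ) = δ ^ 2 * ξ μ ω from fun μ => by ring,
        show ∀ μ ν, δ * (ξ ν ω * (δ * ξ μ ω)) = δ ^ 2 * (ξ μ ω * ξ ν ω) from fun μ ν => by ring]
      abel
  have h1 : ∀ μ, Integrable (fun ω => ξ μ ω • (b A (B μ) + b (B μ) A)) P :=
    fun μ => ((hξ μ).integrable one_le_two).smul_const _
  have h2 : ∀ μ ν, Integrable (fun ω => (ξ μ ω * ξ ν ω) • b (B μ) (B ν)) P :=
    fun μ ν => ((hξ μ).integrable_mul (hξ ν)).smul_const _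
  have h2' : ∀ μ, Integrable (fun ω => ∑ ν, (ξ μ ω * ξ ν ω) • b (B μ) (B ν)) P :=
    fun μ => integrable_finsetSum _ fun ν _ => h2 μ ν
  have hs1 := integrable_finsetSum Finset.univ fun μ _ => h1 μ
  have hs2 := integrable_finsetSum Finset.univ fun μ _ => h2' μ
  rw [integral_congr_ae h, integral_smul, integral_add (integrable_const _) (by exact hs1.add hs2),
    integral_add hs1 hs2,
    integral_finsetSum _ fun μ _ => h1 μ, integral_finsetSum _ fun μ _ => h2' μ]
  simp only [fun μ => integral_finsetSum Finset.univ fun ν _ => h2 μ ν, integral_smul_const, hmean,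
    hcov]
  simp [Finset.smul_sum, ite_smul]

end Moments

/-! ### The one-parameter semigroup of a bounded generator -/

section Exponential

variable {𝔹 : Type*} [NormedRing 𝔹] [NormedAlgebra ℝ 𝔹]

lemma exp_zero_smul (L : 𝔹) : NormedSpace.exp ((0 : ℝ) • L) = 1 := by
  rw [zero_smul, NormedSpace.exp_zero]

variable [CompleteSpace 𝔹]

lemma exp_add_smul (L : 𝔹) (s t : ℝ) :
    NormedSpace.exp ((s + t) • L) = NormedSpace.exp (s • L) * NormedSpace.exp (t • L) := by
  let _ : NormedAlgebra ℚ 𝔹 := .restrictScalars ℚ ℝ 𝔹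
  rw [add_smul, NormedSpace.exp_add_of_commute (((Commute.refl L).smul_left s).smul_right t)]

lemma continuous_exp_smul (L : 𝔹) : Continuous fun s : ℝ => NormedSpace.exp (s • L) :=
  continuous_iff_continuousAt.mpr fun s => (hasDerivAt_exp_smul_const L s).continuousAt

/-- Differentiability at `0` makes the first-order remainder `o(1/m)`, so `m` of them are still
negligible. -/
lemma tendsto_natCast_mul_norm_exp_sub (L : 𝔹) (t : ℝ) :
    Tendsto (fun m : ℕ => m * ‖NormedSpace.exp ((t / m) • L) - (1 + (t / m) • L)‖) atTop (𝓝 0) := by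
  have h := (hasDerivAt_exp_smul_const (𝕂 := ℝ) L 0).isLittleO
  have hlim : Tendsto (fun m : ℕ => t / m) atTop (𝓝 0) := tendsto_const_div_atTop_nhds_zero_nat t
  have h2 := h.comp_tendsto hlim
  have h3 : (fun m : ℕ => NormedSpace.exp ((t / m) • L) - (1 + (t / m) • L)) =o[atTop]
      fun m : ℕ => ((m : ℝ))⁻¹ := by
    refine (h2.trans_isBigO (Asymptotics.IsBigO.of_bound |t| (.of_forall fun m => ?_))).congr_left
      fun m => ?_
    · simp [div_eq_mul_inv]
    · simp [sub_sub]
  have h4 := (Asymptotics.isLittleO_iff_tendsto' ?_).mp h3.norm_left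
  · simpa [mul_comm] using h4
  · filter_upwards [eventually_ne_atTop 0] with m hm h
    simp [hm] at h

end Exponential

/-! ### The mean conjugation over one step -/

section Generator

variable {𝔸 : Type*} [CStarAlgebra 𝔸]

/-- The commutator with `X`, as a continuous linear map. -/
noncomputable def adCLM (X : 𝔸) : 𝔸 →L[ℝ] 𝔸 :=
  ContinuousLinearMap.mul ℝ 𝔸 X - (ContinuousLinearMap.mul ℝ 𝔸).flip X

@[simp] lemma adCLM_apply (X ρ : 𝔸) : adCLM X ρ = ⁅X, ρ⁆ := rfl

lemma norm_adCLM_le (X : 𝔸) : ‖adCLM X‖ ≤ 2 * ‖X‖ :=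
  ContinuousLinearMap.opNorm_le_bound _ (by positivity) fun ρ => by
    rw [mul_assoc]; exact norm_lie_le X ρ

/-- The generator `ρ ↦ [A, ρ] + (a / 2) ∑_μ [B_μ, [B_μ, ρ]]`. -/
noncomputable def doubleCommutatorGenerator {ι : Type*} [Fintype ι] (A : 𝔸) (B : ι → 𝔸) (a : ℝ) :
    𝔸 →L[ℝ] 𝔸 :=
  adCLM A + (a / 2) • ∑ μ, adCLM (B μ) ∘L adCLM (B μ)

lemma doubleCommutatorGenerator_apply {ι : Type*} [Fintype ι] (A : 𝔸) (B : ι → 𝔸) (a : ℝ) (ρ : 𝔸) :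
    doubleCommutatorGenerator A B a ρ = ⁅A, ρ⁆ + (a / 2) • ∑ μ, ⁅B μ, ⁅B μ, ρ⁆⁆ := by
  simp [doubleCommutatorGenerator]

/-- The map `ρ ↦ V ρ V†`. -/
noncomputable def conjCLM (V : 𝔸) : 𝔸 →L[ℝ] 𝔸 := ContinuousLinearMap.mulLeftRight ℝ 𝔸 V (star V)

@[simp] lemma conjCLM_apply (V ρ : 𝔸) : conjCLM V ρ = V * ρ * star V := rfl

lemma continuous_conjCLM : Continuous (conjCLM : 𝔸 → 𝔸 →L[ℝ] 𝔸) := by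
  unfold conjCLM; fun_prop

lemma norm_conjCLM_le_one {V : 𝔸} (hV : V ∈ unitary 𝔸) : ‖conjCLM V‖ ≤ 1 :=
  ContinuousLinearMap.opNorm_le_bound _ zero_le_one fun ρ => by
    rw [conjCLM_apply, norm_unitary_conj_eq hV, one_mul]

variable {Ω : Type*} [MeasurableSpace Ω] {P : Measure Ω}

lemma integrable_conjCLM [IsProbabilityMeasure P] {V : Ω → 𝔸} (hVm : AEStronglyMeasurable V P)
    (hV : ∀ ω, V ω ∈ unitary 𝔸) : Integrable (fun ω => conjCLM (V ω)) P :=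
  .of_bound (continuous_conjCLM.comp_aestronglyMeasurable hVm) 1
    (.of_forall fun ω => norm_conjCLM_le_one (hV ω))

lemma integrable_unitary_conj [IsProbabilityMeasure P] {V : Ω → 𝔸} (hVm : AEStronglyMeasurable V P)
    (hV : ∀ ω, V ω ∈ unitary 𝔸) (ρ : 𝔸) : Integrable (fun ω => V ω * ρ * star (V ω)) P :=
  (integrable_conjCLM hVm hV).apply_continuousLinearMap ρ

lemma integral_conjCLM_apply [IsProbabilityMeasure P] {V : Ω → 𝔸} (hVm : AEStronglyMeasurable V P)
    (hV : ∀ ω, V ω ∈ unitary 𝔸) (ρ : 𝔸) :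
    (∫ ω, conjCLM (V ω) ∂P) ρ = ∫ ω, V ω * ρ * star (V ω) ∂P :=
  ContinuousLinearMap.integral_apply (integrable_conjCLM hVm hV) ρ

lemma norm_integral_conjCLM_le_one [IsProbabilityMeasure P] {V : Ω → 𝔸} (hV : ∀ ω, V ω ∈ unitary 𝔸) :
    ‖∫ ω, conjCLM (V ω) ∂P‖ ≤ 1 := by
  simpa using norm_integral_le_of_norm_le_const (μ := P)
    (.of_forall fun ω => norm_conjCLM_le_one (hV ω))

/-- The bilinear map `(X, Y) ↦ [X, [Y, ρ]]`. -/
noncomputable def doubleLie (ρ : 𝔸) : 𝔸 →ₗ[ℝ] 𝔸 →ₗ[ℝ] 𝔸 :=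
  LinearMap.mk₂ ℝ (fun X Y => ⁅X, ⁅Y, ρ⁆⁆)
    (fun _ _ _ => by simp only [Ring.lie_def]; noncomm_ring)
    (fun _ _ _ => by simp only [Ring.lie_def, smul_mul_assoc, mul_smul_comm, smul_sub])
    (fun _ _ _ => by simp only [Ring.lie_def]; noncomm_ring)
    (fun _ _ _ => by
      simp only [Ring.lie_def, smul_mul_assoc, mul_smul_comm, smul_sub, mul_sub, sub_mul])

@[simp] lemma doubleLie_apply (ρ X Y : 𝔸) : doubleLie ρ X Y = ⁅X, ⁅Y, ρ⁆⁆ := rfl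

/-- The linear map `X ↦ [X, ρ]`. -/
noncomputable def lieRight (ρ : 𝔸) : 𝔸 →L[ℝ] 𝔸 :=
  (ContinuousLinearMap.mul ℝ 𝔸).flip ρ - ContinuousLinearMap.mul ℝ 𝔸 ρ

@[simp] lemma lieRight_apply (ρ X : 𝔸) : lieRight ρ X = ⁅X, ρ⁆ := rfl

lemma integrable_lie [IsProbabilityMeasure P] {X : Ω → 𝔸} (hX : MemLp X 2 P) (ρ : 𝔸) :
    Integrable (fun ω => ⁅X ω, ρ⁆) P :=
  (lieRight ρ).integrable_comp (hX.integrable one_le_two)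

lemma integrable_lie_lie {X : Ω → 𝔸} (hX : MemLp X 2 P) (ρ : 𝔸) :
    Integrable (fun ω => ⁅X ω, ⁅X ω, ρ⁆⁆) P := by
  have hc : Continuous fun Y : 𝔸 => ⁅Y, ⁅Y, ρ⁆⁆ := by simp only [Ring.lie_def]; fun_prop
  refine (hX.norm.integrable_sq.const_mul (4 * ‖ρ‖)).mono' (hc.comp_aestronglyMeasurable hX.1)
    (.of_forall fun ω => ?_)
  have h1 := norm_lie_le (X ω) ⁅X ω, ρ⁆
  have h2 := mul_le_mul_of_nonneg_left (norm_lie_le (X ω) ρ) (norm_nonneg (X ω))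
  nlinarith

/-- The mean conjugation over one short step agrees with the semigroup up to an error of smaller
order. -/
lemma exists_norm_integral_conjCLM_exp_sub_le [IsProbabilityMeasure P] {ι : Type*} [Fintype ι]
    [DecidableEq ι]    (A : 𝔸) (B : ι → 𝔸) (a : ℝ) : ∃ C : ℝ, 0 ≤ C ∧
      ∀ (X : Ω → 𝔸) (ξ : ι → Ω → ℝ) (δ : ℝ), 0 < δ → (∀ ω, X ω ∈ skewAdjoint 𝔸) →
      (∀ μ, MemLp (ξ μ) 2 P) → (∀ μ, ∫ ω, ξ μ ω ∂P = 0) →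
      (∀ μ ν, ∫ ω, ξ μ ω * ξ ν ω ∂P = if μ = ν then a / δ else 0) →
      (∀ᵐ ω ∂P, X ω = δ • (A + ∑ μ, ξ μ ω • B μ)) →
      ‖∫ ω, conjCLM (NormedSpace.exp (X ω)) ∂P -
          NormedSpace.exp (δ • doubleCommutatorGenerator A B a)‖ ≤
        C * (∫ ω, cappedCube ‖X ω‖ ∂P) + C * δ ^ 2 +
          ‖NormedSpace.exp (δ • doubleCommutatorGenerator A B a) -
            (1 + δ • doubleCommutatorGenerator A B a)‖ := by
  obtain ⟨C, hC, hT⟩ := exists_norm_exp_conj_sub_le 𝔸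
  refine ⟨C + 2 * ‖A‖ ^ 2, by positivity, fun X ξ δ hδ hX hξ hmean hcov hXA => ?_⟩
  set L := doubleCommutatorGenerator A B a
  have hXL : MemLp X 2 P := memLp_of_ae_eq_smul_add_sum hξ hXA
  have hVm : AEStronglyMeasurable (fun ω => NormedSpace.exp (X ω)) P :=
    continuous_exp_of_cStarAlgebra.comp_aestronglyMeasurable hXL.1
  have hV : ∀ ω, NormedSpace.exp (X ω) ∈ unitary 𝔸 :=
    fun ω => exp_mem_unitary_of_skewAdjoint (hX ω)
  have hcc0 : 0 ≤ ∫ ω, cappedCube ‖X ω‖ ∂P :=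
    integral_nonneg fun ω => cappedCube_nonneg (norm_nonneg _)
  have hcc := integrable_cappedCube_norm hXL
  have hadA : ‖adCLM A ∘L adCLM A‖ ≤ 4 * ‖A‖ ^ 2 := by
    refine (ContinuousLinearMap.opNorm_comp_le _ _).trans ?_
    have := norm_adCLM_le A
    nlinarith [norm_nonneg (adCLM A), norm_nonneg A]
  -- `Q` is the exact mean of the second-order expansion; beyond `1 + δL` it contains only the
  -- squared drift, whose norm is at most `2‖A‖²δ²`.
  set Q : 𝔸 →L[ℝ] 𝔸 := 1 + δ • L + (δ ^ 2 / 2) • (adCLM A ∘L adCLM A) with hQ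
  have hmain : ‖∫ ω, conjCLM (NormedSpace.exp (X ω)) ∂P - Q‖ ≤
      C * ∫ ω, cappedCube ‖X ω‖ ∂P := by
    refine ContinuousLinearMap.opNorm_le_bound _ (by positivity) fun ρ => ?_
    have hi1 := integrable_lie hXL ρ
    have hi2 : Integrable (fun ω => (1 / 2 : ℝ) • ⁅X ω, ⁅X ω, ρ⁆⁆) P :=
      (integrable_lie_lie hXL ρ).smul (1 / 2 : ℝ)
    have hi12 : Integrable (fun ω => ρ + ⁅X ω, ρ⁆) P := (integrable_const ρ).add hi1
    have hQρ : Q ρ = ∫ ω, (ρ + ⁅X ω, ρ⁆ + (1 / 2 : ℝ) • ⁅X ω, ⁅X ω, ρ⁆⁆) ∂P := by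
      have h1 := integral_linearMap_of_ae_eq_smul_add_sum hξ hmean hXA (lieRight ρ).toLinearMap
      have h2 := integral_bilinear_of_ae_eq_smul_add_sum hξ hmean hcov hXA (doubleLie ρ)
      simp only [ContinuousLinearMap.coe_coe, lieRight_apply, doubleLie_apply] at h1 h2
      rw [integral_add hi12 hi2,
        integral_add (integrable_const ρ) hi1, integral_smul, h1, h2]
      simp only [hQ, L, _root_.add_apply, _root_.smul_apply,
        doubleCommutatorGenerator_apply, integral_const, one_apply_eq_self,
        ContinuousLinearMap.comp_apply, adCLM_apply, probReal_univ, one_smul, smul_add, smul_smul]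
      rw [show 1 / 2 * (δ ^ 2 * (a / δ)) = δ * (a / 2) by field_simp]
      module
    have hi3 : Integrable (fun ω => ρ + ⁅X ω, ρ⁆ + (1 / 2 : ℝ) • ⁅X ω, ⁅X ω, ρ⁆⁆) P := hi12.add hi2
    rw [_root_.sub_apply, integral_conjCLM_apply hVm hV, hQρ,
      ← integral_sub (integrable_unitary_conj hVm hV ρ)
        hi3, mul_assoc,
      mul_comm (∫ ω, _ ∂P), ← mul_assoc, ← integral_const_mul]
    refine norm_integral_le_of_norm_le (hcc.const_mul _) (.of_forall fun ω => ?_)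
    refine (hT _ (hX ω) ρ).trans (le_of_eq (by ring))
  calc _ = ‖(∫ ω, conjCLM (NormedSpace.exp (X ω)) ∂P - Q) + (δ ^ 2 / 2) • (adCLM A ∘L adCLM A) -
          (NormedSpace.exp (δ • L) - (1 + δ • L))‖ := by
        congr 1
        rw [hQ]
        abel
    _ ≤ C * (∫ ω, cappedCube ‖X ω‖ ∂P) + δ ^ 2 / 2 * (4 * ‖A‖ ^ 2) +
          ‖NormedSpace.exp (δ • L) - (1 + δ • L)‖ := by
        refine (norm_sub_le _ _).trans (add_le_add_left ((norm_add_le _ _).trans ?_) _)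
        refine add_le_add hmain ?_
        rw [norm_smul, Real.norm_of_nonneg (by positivity)]
        gcongr
    _ ≤ _ := by
        have h1 : 0 ≤ 2 * ‖A‖ ^ 2 * ∫ ω, cappedCube ‖X ω‖ ∂P := by positivity
        have h2 : 0 ≤ C * δ ^ 2 := by positivity
        nlinarith

end Generator

/-! ### Composition of independent steps -/

section StepProduct

variable {n Ω : Type*} [Fintype n] [DecidableEq n] {W : ℝ≥0 → Ω → skewAdjoint (Matrix n n ℂ)}

lemma stepProduct_succ (δ : ℝ≥0) (ω : Ω) (ℓ : ℕ) : stepProduct W δ ω (ℓ + 1) =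
    NormedSpace.exp (stepIncrement W δ ℓ ω).1 * stepProduct W δ ω ℓ := rfl

lemma exp_coe_mem_unitary (X : skewAdjoint (Matrix n n ℂ)) :
    NormedSpace.exp (X : Matrix n n ℂ) ∈ unitary (Matrix n n ℂ) :=
  exp_mem_unitary_of_skewAdjoint X.2

lemma continuous_exp_coe :
    Continuous fun X : skewAdjoint (Matrix n n ℂ) => NormedSpace.exp (X : Matrix n n ℂ) :=
  continuous_exp_of_cStarAlgebra.comp continuous_subtype_val

lemma stepProduct_mem_unitary (δ : ℝ≥0) (ω : Ω) (ℓ : ℕ) :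
    stepProduct W δ ω ℓ ∈ unitary (Matrix n n ℂ) := by
  induction ℓ with
  | zero => exact one_mem _
  | succ ℓ ih => rw [stepProduct_succ]; exact mul_mem (exp_coe_mem_unitary _) ih

variable [MeasurableSpace Ω] {P : Measure Ω}

/-- The product over the first `ℓ` steps is a measurable function of the first `ℓ` increments. -/
lemma exists_measurable_stepProduct_eq {Ω : Type*} (W : ℝ≥0 → Ω → skewAdjoint (Matrix n n ℂ))
    (δ : ℝ≥0) (ℓ : ℕ) : ∃ g : (Finset.range ℓ → skewAdjoint (Matrix n n ℂ)) → Matrix n n ℂ, Measurable g ∧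
      ∀ ω, stepProduct W δ ω ℓ = g fun i => stepIncrement W δ i ω := by
  induction ℓ with
  | zero => exact ⟨fun _ => 1, measurable_const, fun _ => rfl⟩
  | succ ℓ ih =>
    obtain ⟨g, hg, h⟩ := ih
    refine ⟨fun y => NormedSpace.exp (y ⟨ℓ, Finset.self_mem_range_succ ℓ⟩ : Matrix n n ℂ) *
      g fun i => y ⟨i, Finset.range_subset_range.mpr ℓ.le_succ i.2⟩, ?_, fun ω => ?_⟩
    · refine (continuous_exp_coe.measurable.comp (measurable_pi_apply
        (⟨ℓ, Finset.self_mem_range_succ ℓ⟩ : Finset.range (ℓ + 1)))).mul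
        (hg.comp (measurable_pi_lambda _ fun i => measurable_pi_apply
          (⟨i, Finset.range_subset_range.mpr ℓ.le_succ i.2⟩ : Finset.range (ℓ + 1))))
    · rw [stepProduct_succ, h]

lemma measurable_stepIncrement (hW : ∀ t, Measurable (W t)) (δ : ℝ≥0) (ℓ : ℕ) :
    Measurable (stepIncrement W δ ℓ) := by
  refine Measurable.subtype_mk (f := fun ω =>
    (W ((ℓ + 1) * δ) ω : Matrix n n ℂ) - (W (ℓ * δ) ω : Matrix n n ℂ)) ?_
  exact (measurable_subtype_coe.comp (hW _)).sub (measurable_subtype_coe.comp (hW _))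

lemma measurable_stepProduct (hW : ∀ t, Measurable (W t)) (δ : ℝ≥0) (ℓ : ℕ) :
    Measurable fun ω => stepProduct W δ ω ℓ := by
  obtain ⟨g, hg, h⟩ := exists_measurable_stepProduct_eq W δ ℓ
  simp only [h]
  exact hg.comp (measurable_pi_lambda _ fun i => measurable_stepIncrement hW δ i)

lemma indepFun_stepIncrement_stepProduct (hW : ∀ t, Measurable (W t))
    (hind : HasIndepIncrements W P) (δ : ℝ≥0) (ℓ : ℕ) :
    IndepFun (stepIncrement W δ ℓ) (fun ω => stepProduct W δ ω ℓ) P := by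
  obtain ⟨g, hg, h⟩ := exists_measurable_stepProduct_eq W δ ℓ
  have hi := (hind.iIndepFun_stepIncrement δ).indepFun_finset {ℓ} (Finset.range ℓ) (by simp)
    (measurable_stepIncrement hW δ)
  have := hi.comp (measurable_pi_apply (⟨ℓ, Finset.mem_singleton_self ℓ⟩ : ({ℓ} : Finset ℕ))) hg
  simpa only [Function.comp_def, h] using! this

/-- The mean conjugation by the step product is composed from the mean conjugations by the
exponentials of the single increments. -/
lemma integral_stepProduct_succ_conj [IsProbabilityMeasure P] (hW : ∀ t, Measurable (W t))
    (hind : HasIndepIncrements W P) (δ : ℝ≥0) (ℓ : ℕ) (ρ : Matrix n n ℂ) :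
    ∫ ω, stepProduct W δ ω (ℓ + 1) * ρ * star (stepProduct W δ ω (ℓ + 1)) ∂P =
      (∫ ω, conjCLM (NormedSpace.exp (stepIncrement W δ ℓ ω).1) ∂P)
        (∫ ω, stepProduct W δ ω ℓ * ρ * star (stepProduct W δ ω ℓ) ∂P) := by
  have hX := measurable_stepIncrement hW δ ℓ
  have hS := measurable_stepProduct hW δ ℓ
  have hf : Continuous fun X : skewAdjoint (Matrix n n ℂ) =>
      conjCLM (NormedSpace.exp (X : Matrix n n ℂ)) := continuous_conjCLM.comp continuous_exp_coe
  have hg : Continuous fun V : Matrix n n ℂ => V * ρ * star V := by fun_prop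
  -- The pairing is evaluation of an operator on a matrix, written as the identity map on operators;
  -- independence lets the expectation pass through it.
  have h := (indepFun_stepIncrement_stepProduct hW hind δ ℓ).integral_bilin_comp_comp
    (f := fun X : skewAdjoint (Matrix n n ℂ) => conjCLM (NormedSpace.exp X.1))
    (g := fun V => V * ρ * star V)
    hX.aemeasurable hS.aemeasurable
    ((integrable_map_measure hf.aestronglyMeasurable hX.aemeasurable).mpr
      (integrable_conjCLM (continuous_exp_coe.measurable.comp hX).aestronglyMeasurable
        fun ω => exp_coe_mem_unitary _))
    ((integrable_map_measure hg.aestronglyMeasurable hS.aemeasurable).mpr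
      (integrable_unitary_conj hS.aestronglyMeasurable (fun ω => stepProduct_mem_unitary δ ω ℓ) ρ))
    (ContinuousLinearMap.id ℝ (Matrix n n ℂ →L[ℝ] Matrix n n ℂ))
  simp only [ContinuousLinearMap.id_apply] at h
  rw [← h]
  congr with ω
  simp only [stepProduct_succ, conjCLM_apply, star_mul, mul_assoc]

/-- Telescoping: a new mean conjugation is a contraction, so earlier errors are not amplified, and
its own error acts on a semigroup state of norm at most `K`. -/
lemma norm_integral_stepProduct_conj_sub_le [IsProbabilityMeasure P] (hW : ∀ t, Measurable (W t))
    (hind : HasIndepIncrements W P) (L : Matrix n n ℂ →L[ℝ] Matrix n n ℂ) (δ : ℝ≥0) (m : ℕ)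
    (ρ : Matrix n n ℂ) {K : ℝ}
    (hK : ∀ ℓ < m, ‖NormedSpace.exp ((ℓ * δ : ℝ) • L) ρ‖ ≤ K) :
    ‖∫ ω, stepProduct W δ ω m * ρ * star (stepProduct W δ ω m) ∂P -
        NormedSpace.exp ((m * δ : ℝ) • L) ρ‖ ≤
      K * ∑ ℓ ∈ Finset.range m,
        ‖∫ ω, conjCLM (NormedSpace.exp (stepIncrement W δ ℓ ω).1) ∂P -
          NormedSpace.exp ((δ : ℝ) • L)‖ := by
  induction m with
  | zero => simp [stepProduct, exp_zero_smul L]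
  | succ m ih =>
    have ih := ih fun ℓ hℓ => hK ℓ (hℓ.trans m.lt_succ_self)
    rw [integral_stepProduct_succ_conj hW hind, Finset.sum_range_succ, mul_add]
    set Φ := ∫ ω, conjCLM (NormedSpace.exp (stepIncrement W δ m ω).1) ∂P
    set σ := ∫ ω, stepProduct W δ ω m * ρ * star (stepProduct W δ ω m) ∂P
    set τ := NormedSpace.exp ((m * δ : ℝ) • L) ρ
    have hτ : NormedSpace.exp (((m + 1 : ℕ) * δ : ℝ) • L) ρ =
        NormedSpace.exp ((δ : ℝ) • L) τ := by
      rw [show (((m + 1 : ℕ) : ℝ) * δ) = δ + m * δ by push_cast; ring, exp_add_smul L]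
      rfl
    have hΦ : ‖Φ‖ ≤ 1 := norm_integral_conjCLM_le_one fun ω => exp_coe_mem_unitary _
    have hdec : Φ σ - NormedSpace.exp ((δ : ℝ) • L) τ =
        Φ (σ - τ) + (Φ - NormedSpace.exp ((δ : ℝ) • L)) τ := by
      rw [map_sub, _root_.sub_apply]; abel
    rw [hτ, hdec]
    refine (norm_add_le _ _).trans (add_le_add ?_ ?_)
    · exact ((Φ.le_opNorm _).trans (mul_le_of_le_one_left (norm_nonneg _) hΦ)).trans ih
    · refine ((Φ - NormedSpace.exp ((δ : ℝ) • L)).le_opNorm _).trans ?_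
      rw [mul_comm]
      exact mul_le_mul_of_nonneg_right (hK m m.lt_succ_self) (norm_nonneg _)

end StepProduct

/-! ### Passage to the continuous-time limit -/

section Limit

variable {n ι Ω : Type*} [Fintype n] [DecidableEq n] [Fintype ι] [DecidableEq ι]
  [MeasurableSpace Ω] {P : Measure Ω} [IsProbabilityMeasure P]

/-- The mean conjugation by the step products converges to the semigroup. -/
lemma tendsto_integral_stepProduct_conj (A : Matrix n n ℂ) (B : ι → Matrix n n ℂ) (a : ℝ)
    {W : ℝ≥0 → Ω → skewAdjoint (Matrix n n ℂ)} (hW : IsLieAlgebraBrownianMotion W P)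
    {ξ : ι → ℕ → ℝ≥0 → Ω → ℝ}
    (hΘ : ∀ (ℓ : ℕ) (δ : ℝ≥0), 0 < δ → ∀ᵐ ω ∂P,
      lieIncrement W ℓ δ ω = A + ∑ μ, ξ μ ℓ δ ω • B μ)
    (hξ : ∀ (μ : ι) (ℓ : ℕ) (δ : ℝ≥0), 0 < δ → MemLp (ξ μ ℓ δ) 2 P)
    (hmean : ∀ (μ : ι) (ℓ : ℕ) (δ : ℝ≥0), 0 < δ → ∫ ω, ξ μ ℓ δ ω ∂P = 0)
    (hcov : ∀ (μ ν : ι) (ℓ : ℕ) (δ : ℝ≥0), 0 < δ →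
      ∫ ω, ξ μ ℓ δ ω * ξ ν ℓ δ ω ∂P = if μ = ν then a / (δ : ℝ) else 0)
    {t : ℝ≥0} (ht : 0 < t) (ρ : Matrix n n ℂ) :
    Tendsto (fun m : ℕ => ∫ ω, stepProduct W (t / m) ω m * ρ * star (stepProduct W (t / m) ω m) ∂P)
      atTop (𝓝 (NormedSpace.exp ((t : ℝ) • doubleCommutatorGenerator A B a) ρ)) := by
  set L := doubleCommutatorGenerator A B a
  set V : ℝ≥0 → Ω → Matrix n n ℂ := fun t ω => (W t ω : Matrix n n ℂ)
  have hXV : ∀ δ ℓ ω, (stepIncrement W δ ℓ ω).1 = stepIncrement V δ ℓ ω :=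
    fun _ _ _ => rfl
  have hX : ∀ (δ : ℝ≥0), 0 < δ → ∀ ℓ, ∀ᵐ ω ∂P,
      stepIncrement V δ ℓ ω = (δ : ℝ) • (A + ∑ μ, ξ μ ℓ δ ω • B μ) := fun δ hδ ℓ => by
    filter_upwards [hΘ ℓ δ hδ] with ω hω
    rw [← hω, lieIncrement, smul_smul, mul_inv_cancel₀ (by exact_mod_cast hδ.ne'), one_smul]
    rfl
  have hL2 : ∀ (δ : ℝ≥0), 0 < δ → ∀ ℓ, MemLp (stepIncrement V δ ℓ) 2 P :=
    fun δ hδ ℓ => memLp_of_ae_eq_smul_add_sum (fun μ => hξ μ ℓ δ hδ) (hX δ hδ ℓ)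
  have hlind : Tendsto (fun m : ℕ => ∑ ℓ ∈ Finset.range m,
      ∫ ω, cappedCube ‖stepIncrement V (t / m) ℓ ω‖ ∂P) atTop (𝓝 0) :=
    tendsto_sum_integral_cappedCube_norm_stepIncrement
      (fun t => measurable_subtype_coe.comp (hW.measurable t))
      (hW.indep_increments.map' (f := (skewAdjoint (Matrix n n ℂ)).subtype) measurable_subtype_coe)
      (hW.continuous_paths.mono fun ω hω => continuous_subtype_val.comp hω) A hL2
      (fun δ hδ ℓ => integral_linearMap_of_ae_eq_smul_add_sum (fun μ => hξ μ ℓ δ hδ)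
        (fun μ => hmean μ ℓ δ hδ) (hX δ hδ ℓ) LinearMap.id) ht
  obtain ⟨C, hC, hstep⟩ := exists_norm_integral_conjCLM_exp_sub_le (P := P) A B a
  -- Compactness of `[0, t]` gives one bound for the semigroup orbit at every mesh point, uniformly
  -- in `m`.
  obtain ⟨K, hK⟩ := (isCompact_Icc (a := (0 : ℝ)) (b := t)).exists_bound_of_continuousOn
    ((ContinuousLinearMap.apply ℝ (Matrix n n ℂ) ρ).continuous.comp
      (continuous_exp_smul L)).continuousOn
  have hK0 : 0 ≤ K := (norm_nonneg _).trans (hK 0 ⟨le_rfl, t.2⟩)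
  have hlim : Tendsto (fun m : ℕ => K * (C * (∑ ℓ ∈ Finset.range m,
      ∫ ω, cappedCube ‖stepIncrement V (t / m) ℓ ω‖ ∂P) + C * ((t : ℝ) ^ 2 / m) +
        m * ‖NormedSpace.exp (((t : ℝ) / m) • L) - (1 + ((t : ℝ) / m) • L)‖)) atTop (𝓝 0) := by
    simpa using (((hlind.const_mul C).add
      ((tendsto_const_div_atTop_nhds_zero_nat ((t : ℝ) ^ 2)).const_mul C)).add
        (tendsto_natCast_mul_norm_exp_sub L t)).const_mul K
  rw [tendsto_iff_norm_sub_tendsto_zero]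
  refine squeeze_zero' (.of_forall fun m => norm_nonneg _) ?_ hlim
  filter_upwards [eventually_ne_atTop 0] with m hm
  have hm' : (m : ℝ) ≠ 0 := by exact_mod_cast hm
  have hδ : 0 < t / m := by positivity
  have hδc : ((t / m : ℝ≥0) : ℝ) = t / m := by push_cast; rfl
  have h := norm_integral_stepProduct_conj_sub_le hW.measurable hW.indep_increments L (t / m) m ρ
    (K := K) fun ℓ hℓ => by
      refine hK _ ⟨by positivity, ?_⟩
      have hℓ' : (ℓ : ℝ) ≤ m := by exact_mod_cast hℓ.le
      calc (ℓ : ℝ) * ((t / m : ℝ≥0) : ℝ) ≤ m * ((t / m : ℝ≥0) : ℝ) := by gcongr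
        _ = t := by rw [hδc]; field_simp
  rw [hδc, mul_div_cancel₀ _ hm'] at h
  refine h.trans (mul_le_mul_of_nonneg_left ?_ hK0)
  calc _ ≤ ∑ ℓ ∈ Finset.range m, (C * (∫ ω, cappedCube ‖stepIncrement V (t / m) ℓ ω‖ ∂P) +
        C * ((t : ℝ) / m) ^ 2 +
          ‖NormedSpace.exp (((t : ℝ) / m) • L) - (1 + ((t : ℝ) / m) • L)‖) := by
        refine Finset.sum_le_sum fun ℓ _ => ?_
        rw [← hδc]
        exact hstep _ (fun μ => ξ μ ℓ (t / m)) _ (by exact_mod_cast hδ)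
          (fun ω => (stepIncrement W (t / m) ℓ ω).2) (fun μ => hξ μ ℓ _ hδ)
          (fun μ => hmean μ ℓ _ hδ) (fun μ ν => hcov μ ν ℓ _ hδ) (hX _ hδ ℓ)
    _ = _ := by
        rw [Finset.sum_add_distrib, Finset.sum_add_distrib, ← Finset.mul_sum]
        simp only [Finset.sum_const, Finset.card_range, nsmul_eq_mul]
        field_simp

/-- The averaged state is the solution `exp (t L) ρ` of the Lindblad equation. -/
lemma averagedState_eq_exp (A : Matrix n n ℂ) (B : ι → Matrix n n ℂ) (a : ℝ)
    {W : ℝ≥0 → Ω → skewAdjoint (Matrix n n ℂ)} (hW : IsLieAlgebraBrownianMotion W P)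
    {ξ : ι → ℕ → ℝ≥0 → Ω → ℝ}
    (hΘ : ∀ (ℓ : ℕ) (δ : ℝ≥0), 0 < δ → ∀ᵐ ω ∂P,
      lieIncrement W ℓ δ ω = A + ∑ μ, ξ μ ℓ δ ω • B μ)
    (hξ : ∀ (μ : ι) (ℓ : ℕ) (δ : ℝ≥0), 0 < δ → MemLp (ξ μ ℓ δ) 2 P)
    (hmean : ∀ (μ : ι) (ℓ : ℕ) (δ : ℝ≥0), 0 < δ → ∫ ω, ξ μ ℓ δ ω ∂P = 0)
    (hcov : ∀ (μ ν : ι) (ℓ : ℕ) (δ : ℝ≥0), 0 < δ →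
      ∫ ω, ξ μ ℓ δ ω * ξ ν ℓ δ ω ∂P = if μ = ν then a / (δ : ℝ) else 0)
    {U : ℝ≥0 → Ω → Matrix.unitaryGroup n ℂ} (hU₀ : ∀ᵐ ω ∂P, U 0 ω = 1)
    (hUW : IsProductIntegral U W P) (ρ : Matrix n n ℂ) (t : ℝ≥0) :
    averagedState U P ρ t =
      NormedSpace.exp ((t : ℝ) • doubleCommutatorGenerator A B a) ρ := by
  -- Time `0` is separate because the increment hypotheses require positive step length.
  rcases eq_or_lt_of_le (zero_le (a := t)) with rfl | ht
  · have h : averagedState U P ρ 0 = ∫ _, ρ ∂P := integral_congr_ae <| by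
      filter_upwards [hU₀] with ω hω
      simp [hω]
    rw [h, NNReal.coe_zero, exp_zero_smul (doubleCommutatorGenerator A B a)]
    simp
  have hlim := tendsto_integral_stepProduct_conj A B a hW hΘ hξ hmean hcov ht ρ
  -- An almost surely convergent subsequence suffices, because the limit of the full sequence of
  -- means is already known.
  obtain ⟨ns, hns, hae⟩ := (hUW t).exists_seq_tendsto_ae
  refine tendsto_nhds_unique ?_ (hlim.comp hns.tendsto_atTop)
  refine tendsto_integral_of_dominated_convergence (fun _ => ‖ρ‖) (fun k => ?_)
    (integrable_const _) (fun k => .of_forall fun ω => ?_) ?_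
  · have hc : Continuous fun V : Matrix n n ℂ => V * ρ * star V := by fun_prop
    exact (hc.measurable.comp (measurable_stepProduct hW.measurable _ _)).aestronglyMeasurable
  · exact (norm_unitary_conj_eq (stepProduct_mem_unitary _ _ _) ρ).le
  · filter_upwards [hae, hU₀] with ω hω h0
    have hc : Continuous fun V : Matrix n n ℂ => V * ρ * star V := by fun_prop
    have := (hc.tendsto _).comp hω
    simpa [h0, Function.comp_def, Matrix.star_eq_conjTranspose] using this

end Limit

/-! ### Complete positivity and trace preservation of the average -/

section CompletelyPositive

/-- The positive cone is closed and convex, so it contains the mean of any integrable function with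
values in it. -/
lemma map_integral_nonneg {Ω F 𝔸 : Type*} [MeasurableSpace Ω] {P : Measure Ω}
    [IsProbabilityMeasure P] [NormedAddCommGroup F] [NormedSpace ℝ F] [CompleteSpace F]
    [CStarAlgebra 𝔸] [PartialOrder 𝔸] [StarOrderedRing 𝔸] (f : F →L[ℝ] 𝔸) {g : Ω → F}
    (hg : Integrable g P) (h : ∀ ω, 0 ≤ f (g ω)) : 0 ≤ f (∫ ω, g ω ∂P) := by
  rw [← f.integral_comp_comm hg]
  exact (convex_Ici (𝕜 := ℝ) (0 : 𝔸)).integral_mem CStarAlgebra.isClosed_nonneg (.of_forall h)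
    (f.integrable_comp hg)

variable {n Ω : Type*} [Fintype n] [DecidableEq n]

/-- Conjugation by a unitary is completely positive. -/
lemma cStarMatrix_map_conjCLM_nonneg {V : Matrix n n ℂ} (hV : V ∈ unitary (Matrix n n ℂ)) {k : ℕ}
    {M : CStarMatrix (Fin k) (Fin k) (Matrix n n ℂ)} (hM : 0 ≤ M) : 0 ≤ M.map (conjCLM V) :=
  CompletelyPositiveMapClass.map_cstarMatrix_nonneg'
    (Unitary.conjStarAlgAut ℂ (Matrix n n ℂ) ⟨V, hV⟩) k M hM

/-- Entrywise application to a fixed matrix of matrices, as a function of the map. -/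
noncomputable def cStarMatrixMapCLM {k : ℕ} (M : CStarMatrix (Fin k) (Fin k) (Matrix n n ℂ)) :
    (Matrix n n ℂ →L[ℝ] Matrix n n ℂ) →L[ℝ] CStarMatrix (Fin k) (Fin k) (Matrix n n ℂ) :=
  LinearMap.toContinuousLinearMap
    { toFun := fun T => M.map T
      map_add' := fun _ _ => rfl
      map_smul' := fun _ _ => rfl }

variable [MeasurableSpace Ω] {P : Measure Ω} [IsProbabilityMeasure P]
  {U : ℝ≥0 → Ω → Matrix.unitaryGroup n ℂ}

lemma integrable_averagedState (hU : ∀ t, Measurable (U t)) (ρ : Matrix n n ℂ) (t : ℝ≥0) :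
    Integrable (fun ω => (U t ω : Matrix n n ℂ) * ρ * (U t ω : Matrix n n ℂ)ᴴ) P :=
  integrable_unitary_conj (measurable_subtype_coe.comp (hU t)).aestronglyMeasurable
    (fun ω => (U t ω).2) ρ

lemma integral_conjCLM_apply_eq_averagedState (hU : ∀ t, Measurable (U t)) (ρ : Matrix n n ℂ)
    (t : ℝ≥0) : (∫ ω, conjCLM (U t ω : Matrix n n ℂ) ∂P) ρ = averagedState U P ρ t :=
  integral_conjCLM_apply (measurable_subtype_coe.comp (hU t)).aestronglyMeasurable
    (fun ω => (U t ω).2) ρ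

/-- Averaging over unitary conjugations, as a completely positive map. -/
noncomputable def averagedStateCP (hU : ∀ t, Measurable (U t)) (P : Measure Ω)
    [IsProbabilityMeasure P] (t : ℝ≥0) : Matrix n n ℂ →CP Matrix n n ℂ where
  toFun ρ := averagedState U P ρ t
  map_add' ρ σ := by
    simp only [← integral_conjCLM_apply_eq_averagedState hU, map_add]
  -- `conjCLM` is only real-linear, so complex homogeneity is checked on the integral itself.
  map_smul' c ρ := by
    simp only [averagedState, RingHom.id_apply, ← integral_smul, Matrix.mul_smul, Matrix.smul_mul]
  map_cstarMatrix_nonneg' k M hM := by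
    have hi : Integrable (fun ω => conjCLM (U t ω : Matrix n n ℂ)) P :=
      integrable_conjCLM (measurable_subtype_coe.comp (hU t)).aestronglyMeasurable
        fun ω => (U t ω).2
    -- Entrywise application is real-linear and continuous in the applied map, so positivity of each
    -- unitary conjugation passes to the mean.
    have h : M.map (fun ρ => averagedState U P ρ t) =
        cStarMatrixMapCLM M (∫ ω, conjCLM (U t ω : Matrix n n ℂ) ∂P) := by
      refine CStarMatrix.ext fun i j => ?_
      exact (integral_conjCLM_apply_eq_averagedState (P := P) hU (M i j) t).symm
    change 0 ≤ M.map (fun ρ => averagedState U P ρ t)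
    rw [h]
    exact map_integral_nonneg (cStarMatrixMapCLM M) hi
      fun ω => cStarMatrix_map_conjCLM_nonneg (U t ω).2 hM

lemma averagedStateCP_apply (hU : ∀ t, Measurable (U t)) (t : ℝ≥0) (ρ : Matrix n n ℂ) :
    averagedStateCP hU P t ρ = averagedState U P ρ t := rfl

lemma trace_averagedState (hU : ∀ t, Measurable (U t)) (ρ : Matrix n n ℂ) (t : ℝ≥0) :
    (averagedState U P ρ t).trace = ρ.trace := by
  have h := (LinearMap.toContinuousLinearMap (Matrix.traceLinearMap n ℂ ℂ)).integral_comp_comm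
    (integrable_averagedState (P := P) hU ρ t)
  have h2 : ∀ ω, ((U t ω : Matrix n n ℂ) * ρ * (U t ω : Matrix n n ℂ)ᴴ).trace = ρ.trace :=
    fun ω => by
      rw [Matrix.trace_mul_comm, ← mul_assoc, ← Matrix.star_eq_conjTranspose,
        Unitary.star_mul_self_of_mem (U t ω).2, one_mul]
  simp only [LinearMap.coe_toContinuousLinearMap', Matrix.traceLinearMap_apply, h2] at h
  simpa [averagedState] using h.symm

end CompletelyPositive

/-! ### Identification of the generator and the theorem -/

/-- For anti-Hermitian jump operators the Lindblad generator consists of commutators. -/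
lemma lindbladGenerator_eq_doubleCommutatorGenerator {n ι : Type*} [Fintype n] [DecidableEq n]
    [Fintype ι] (H₀ : Matrix n n ℂ) {B : ι → Matrix n n ℂ} (hB : ∀ μ, (B μ)ᴴ = -B μ) (a : ℝ)
    (ρ : Matrix n n ℂ) :
    lindbladGenerator H₀ B a ρ = doubleCommutatorGenerator ((-Complex.I) • H₀) B a ρ := by
  rw [doubleCommutatorGenerator_apply, lindbladGenerator, Ring.lie_def, Matrix.smul_mul,
    Matrix.mul_smul, ← smul_sub, Finset.smul_sum, Finset.smul_sum]
  congr 1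
  refine Finset.sum_congr rfl fun μ _ => ?_
  -- With `B† = -B` both sides become `½(B²ρ - 2BρB + ρB²)`, up to the factor `a`.
  simp only [hB, Ring.lie_def, mul_sub, sub_mul, neg_mul, mul_neg, mul_assoc]
  module

theorem proposition1 {n ι Ω : Type*} [Fintype n] [DecidableEq n] [Fintype ι] [DecidableEq ι]
    [MeasurableSpace Ω] (P : Measure Ω) [IsProbabilityMeasure P]
    -- the Hamiltonian, the noise operators, the noise strength
    (H₀ : Matrix n n ℂ) (hH₀ : H₀.IsHermitian)
    (B : ι → Matrix n n ℂ) (hB : ∀ μ, (B μ)ᴴ = -B μ) (a : ℝ)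
    -- the driving Brownian motion on the Lie algebra and its increments
    (W : ℝ≥0 → Ω → skewAdjoint (Matrix n n ℂ)) (hW : IsLieAlgebraBrownianMotion W P)
    (ξ : ι → ℕ → ℝ≥0 → Ω → ℝ)
    (hΘ : ∀ (ℓ : ℕ) (δ : ℝ≥0), 0 < δ → ∀ᵐ ω ∂P,
      lieIncrement W ℓ δ ω = (-Complex.I) • H₀ + ∑ μ, ξ μ ℓ δ ω • B μ)
    (hξ : ∀ (μ : ι) (ℓ : ℕ) (δ : ℝ≥0), 0 < δ → MemLp (ξ μ ℓ δ) 2 P)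
    (hmean : ∀ (μ : ι) (ℓ : ℕ) (δ : ℝ≥0), 0 < δ → ∫ ω, ξ μ ℓ δ ω ∂P = 0)
    (hcov : ∀ (μ ν : ι) (ℓ : ℕ) (δ : ℝ≥0), 0 < δ →
      ∫ ω, ξ μ ℓ δ ω * ξ ν ℓ δ ω ∂P = if μ = ν then a / (δ : ℝ) else 0)
    -- the unitary Brownian motion generated by these increments
    (U : ℝ≥0 → Ω → Matrix.unitaryGroup n ℂ) (hU : IsUnitaryBrownianMotion U P)
    (hU₀ : ∀ᵐ ω ∂P, U 0 ω = 1) (hUW : IsProductIntegral U W P) :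
    (∀ (ρ : Matrix n n ℂ) (t : ℝ≥0),
      Integrable (fun ω => (U t ω : Matrix n n ℂ) * ρ * (U t ω : Matrix n n ℂ)ᴴ) P) ∧
    (∃ T : ℝ≥0 → (Matrix n n ℂ →CP Matrix n n ℂ),
      IsQuantumDynamicalSemigroup T ∧ ∀ t ρ, T t ρ = averagedState U P ρ t) ∧
    (∀ ρ : Matrix n n ℂ, averagedState U P ρ 0 = ρ ∧
      ∀ t : ℝ≥0, HasDerivWithinAt (fun s : ℝ => averagedState U P ρ s.toNNReal)
        (lindbladGenerator H₀ B a (averagedState U P ρ t)) (Set.Ici 0) (t : ℝ)) := by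
  set L := doubleCommutatorGenerator ((-Complex.I) • H₀) B a with hL
  have hexp : ∀ ρ t, averagedState U P ρ t = NormedSpace.exp ((t : ℝ) • L) ρ :=
    averagedState_eq_exp _ B a hW hΘ hξ hmean hcov hU₀ hUW
  have hzero : ∀ ρ, averagedState U P ρ 0 = ρ := fun ρ => by
    rw [hexp, NNReal.coe_zero, exp_zero_smul L]
    rfl
  refine ⟨integrable_averagedState hU.measurable, ⟨averagedStateCP hU.measurable P, ⟨hzero, ?_,
    fun t ρ => trace_averagedState hU.measurable ρ t, fun ρ => ?_⟩, fun _ _ => rfl⟩,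
    fun ρ => ⟨hzero ρ, fun t => ?_⟩⟩
  · intro s t ρ
    simp only [averagedStateCP_apply, hexp]
    rw [NNReal.coe_add, exp_add_smul L]
    rfl
  · simp only [averagedStateCP_apply, hexp]
    exact (ContinuousLinearMap.apply ℝ (Matrix n n ℂ) ρ).continuous.comp
      ((continuous_exp_smul L).comp NNReal.continuous_coe)
  · rw [lindbladGenerator_eq_doubleCommutatorGenerator H₀ hB, hexp, ← hL]
    have hd : HasDerivAt (fun s : ℝ => NormedSpace.exp (s • L) ρ)
        (L (NormedSpace.exp ((t : ℝ) • L) ρ)) t :=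
      (ContinuousLinearMap.apply ℝ (Matrix n n ℂ) ρ).hasFDerivAt.comp_hasDerivAt (t : ℝ)
        (hasDerivAt_exp_smul_const' (𝕂 := ℝ) L (t : ℝ))
    -- The extension by `toNNReal` agrees with the exponential only for `s ≥ 0`, which is all that
    -- the derivative within `Set.Ici 0` sees.
    refine hd.hasDerivWithinAt.congr (fun s hs => ?_) ?_
    · rw [hexp, Real.coe_toNNReal s hs]
    · rw [hexp, Real.toNNReal_coe]
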